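/- **Proposition 4.6.** Let $\mathcal B$ be a bicategory all of whose categories of 1-morphisms are idempotent complete. Write $Y\otimes X: a\to c$ for the composite of $X: a\to b$ and $Y:b\to c$, and suppress associators and unitors. Assume that $\mathcal B$ is pivotal: for every 1-morphism $X:a\to b$ a 1-morphism $X^\dagger={}^\dagger X:b\to a$ is chosen which is both left and right adjoint to $X$, with chosen adjunction 2-morphisms $$\mathrm{ev}_X: X^\dagger\otimes X\to I_a,\quad \mathrm{coev}_X: I_b\to X\otimes X^\dagger,\qquad \widetilde{\mathrm{ev}}_X: X\otimes X^\dagger\to I_b,\quad \widetilde{\mathrm{coev}}_X: I_a\to X^\dagger\otimes X$$ (each pair satisfying the zigzag identities), such that for every 2-morphism $\phi:Z\to X$ the two induced maps $X^\dagger\to Z^\dagger$ (one formed with $\widetilde{\mathrm{ev}}_X,\widetilde{\mathrm{coev}}_Z$, the other with $\mathrm{ev}_X,\mathrm{coev}_Z$) are equal, and for all composable $X,Y$ the two canonical maps $(Y\otimes X)^\dagger\to X^\dagger\otimes Y^\dagger$ (one formed with $\widetilde{\mathrm{ev}}_{Y\otimes X},\widetilde{\mathrm{coev}}_X,\widetilde{\mathrm{coev}}_Y$,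 the other with $\mathrm{ev}_{Y\otimes X},\mathrm{coev}_X,\mathrm{coev}_Y$) are equal. Let $\mathcal B_{\mathrm{eq}}$ be the bicategory whose objects are pairs $(a,A)$ with $a\in\mathcal B$ and $A=(A,\mu,\eta,\Delta,\varepsilon)$ a separable ($\mu\circ\Delta=1_A$), not necessarily symmetric, Frobenius algebra in $\mathcal B(a,a)$; whose 1-morphisms $(a,A)\to(b,B)$ are $B$-$A$-bimodules $X\in\mathcal B(a,b)$; and whose 2-morphisms are bimodule maps. The unit 1-morphism of $(a,A)$ is $A$, and the composite of $X:(a,A)\to(b,B)$ and $Y:(b,B)\to(c,C)$ is $Y\otimes_B X$, the image of the idempotent on $Y\otimes X$ which inserts $\Delta\circ\eta:I_b\to B\otimes B$ between $Y$ and $X$ and lets the two legs act on $Y$ and $X$; let $\xi:Y\otimes_B X\to Y\otimes X$ and $\vartheta:Y\otimes X\to Y\otimes_B X$ be the splitting and projection maps. For a Frobenius algebra $A$ let $\gamma_A$ be the Nakayama automorphism $$\gamma_A=(\mathrm{ev}_A\otimes 1_A)\circ(1_{A^\dagger}\otimes(\Delta\circ\eta))\circ(1_{A^\dagger}\otimes(\varepsilon\circ\mu))\circ(\widetilde{\mathrm{coev}}_A\otimes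 1_A):A\to A,$$ which is an algebra automorphism with inverse $\gamma_A^{-1}=(1_A\otimes\widetilde{\mathrm{ev}}_A)\circ((\Delta\circ\eta)\otimes 1_{A^\dagger})\circ((\varepsilon\circ\mu)\otimes 1_{A^\dagger})\circ(1_A\otimes\mathrm{coev}_A)$. For algebra automorphisms $\beta,\alpha$ write ${}_\beta X_\alpha$ for the bimodule $X$ with left and right action precomposed with $\beta$ and $\alpha$, respectively. For a $B$-$A$-bimodule $X$ with left action $\lambda:B\otimes X\to X$ and right action $\rho:X\otimes A\to X$, regard $X^\dagger$ as an $A$-$B$-bimodule with left action $$A\otimes X^\dagger\xrightarrow{\widetilde{\mathrm{coev}}_X\otimes 1}X^\dagger\otimes X\otimes A\otimes X^\dagger\xrightarrow{1\otimes\rho\otimes 1}X^\dagger\otimes X\otimes X^\dagger\xrightarrow{1\otimes\widetilde{\mathrm{ev}}_X}X^\dagger,$$ and right action $$X^\dagger\otimes B\xrightarrow{\widetilde{\mathrm{coev}}_X\otimes1}X^\dagger\otimes X\otimes X^\dagger\otimes B\xrightarrow{1\otimes\widetilde{\mathrm{coev}}_B\otimes1}X^\dagger\otimes B^\dagger\otimes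 B\otimes X\otimes X^\dagger\otimes B\xrightarrow{1\otimes\lambda\otimes 1}X^\dagger\otimes B^\dagger\otimes X\otimes X^\dagger\otimes B\xrightarrow{1\otimes\widetilde{\mathrm{ev}}_X\otimes1}X^\dagger\otimes B^\dagger\otimes B\xrightarrow{1\otimes\mathrm{ev}_B}X^\dagger .$$ Then $\mathcal B_{\mathrm{eq}}$ has left and right adjoints. Precisely, let $X:(a,A)\to(b,B)$ be a 1-morphism of $\mathcal B_{\mathrm{eq}}$. 1. ${}^\star X:={}_{\gamma_A^{-1}}({}^\dagger X)$ is left adjoint to $X$ in $\mathcal B_{\mathrm{eq}}$, with evaluation ${}^\star X\otimes_B X\to A$ and coevaluation $B\to X\otimes_A{}^\star X$ given by $$(\mathrm{ev}_X\otimes1_A)\circ(1_{{}^\dagger X}\otimes\rho\otimes1_A)\circ(1_{{}^\dagger X\otimes X}\otimes(\Delta\circ\eta))\circ\xi,\qquad \vartheta\circ(\lambda\otimes1_{{}^\dagger X})\circ(1_B\otimes\mathrm{coev}_X).$$ 2. $X^\star:=(X^\dagger)_{\gamma_B}$ is right adjoint to $X$ in $\mathcal B_{\mathrm{eq}}$,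 with evaluation $X\otimes_A X^\star\to B$ and coevaluation $A\to X^\star\otimes_B X$ given by $$(1_B\otimes\widetilde{\mathrm{ev}}_X)\circ(1_B\otimes\lambda\otimes1_{X^\dagger})\circ((\Delta\circ\eta)\otimes1_{X\otimes X^\dagger})\circ\xi,\qquad \vartheta\circ(1_{X^\dagger}\otimes\rho)\circ(\widetilde{\mathrm{coev}}_X\otimes1_A).$$ In particular these four 2-morphisms of $\mathcal B$ are bimodule maps and satisfy the zigzag identities in $\mathcal B_{\mathrm{eq}}$. -/

import Mathlib

open CategoryTheory Bicategory

/-! Conventions. Mathlib composes 1-morphisms in diagrammatic order, so the horizontal composite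
`Y ⊗ X` of `X : a → b` and `Y : b → c` is written `X ≫ Y`. Consequently a left action of an
algebra `B` on `X : a → b` is a 2-morphism `X ≫ B ⟶ X`, and a right action of `A` is a
2-morphism `A ≫ X ⟶ X`. The symbol `⊗≫` is vertical composition of 2-morphisms up to
structural coherence isomorphisms. -/

universe w v u

namespace EquivariantCompletion

/-- A Frobenius algebra in `B(a, a)`: a unital associative algebra and a counital coassociative
coalgebra on the same 1-morphism whose comultiplication is a bimodule map. It is not assumed to
be symmetric. -/
structure FrobeniusAlgebra {B : Type u} [Bicategory.{w, v} B] (a : B) where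
  obj : a ⟶ a
  mul : obj ≫ obj ⟶ obj
  one : 𝟙 a ⟶ obj
  comul : obj ⟶ obj ≫ obj
  counit : obj ⟶ 𝟙 a
  mul_assoc : mul ▷ obj ≫ mul = (α_ obj obj obj).hom ≫ obj ◁ mul ≫ mul
  one_mul : one ▷ obj ≫ mul = (λ_ obj).hom
  mul_one : obj ◁ one ≫ mul = (ρ_ obj).hom
  comul_coassoc : comul ≫ comul ▷ obj ≫ (α_ obj obj obj).hom = comul ≫ obj ◁ comul
  counit_comul : comul ≫ counit ▷ obj = (λ_ obj).inv
  comul_counit : comul ≫ obj ◁ counit = (ρ_ obj).inv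
  frobenius_left : obj ◁ comul ≫ (α_ obj obj obj).inv ≫ mul ▷ obj = mul ≫ comul
  frobenius_right : comul ▷ obj ≫ (α_ obj obj obj).hom ≫ obj ◁ mul = mul ≫ comul

/-- A Frobenius algebra is separable if multiplication after comultiplication is the identity. -/
structure SepFrobeniusAlgebra {B : Type u} [Bicategory.{w, v} B] (a : B) extends
    FrobeniusAlgebra a where
  separable : comul ≫ mul = 𝟙 obj

/-- Objects of the equivariant completion `B_eq`: an object `a` of `B` together with a separable
Frobenius algebra in `B(a, a)`. -/
structure Beq (B : Type u) [Bicategory.{w, v} B] where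
  base : B
  alg : SepFrobeniusAlgebra base

variable {B : Type u} [Bicategory.{w, v} B]

/-- 1-morphisms `(a, A) → (b, B)` of `B_eq`: `B`-`A`-bimodules, i.e. 1-morphisms `a → b` with
commuting unital associative left action of `B` and right action of `A`. -/
structure Bimodule (a b : Beq B) where
  obj : a.base ⟶ b.base
  lact : obj ≫ b.alg.obj ⟶ obj
  ract : a.alg.obj ≫ obj ⟶ obj
  lact_assoc : lact ▷ b.alg.obj ≫ lact =
    (α_ obj b.alg.obj b.alg.obj).hom ≫ obj ◁ b.alg.mul ≫ lact
  lact_one : obj ◁ b.alg.one ≫ lact = (ρ_ obj).hom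
  ract_assoc : a.alg.mul ▷ obj ≫ ract =
    (α_ a.alg.obj a.alg.obj obj).hom ≫ a.alg.obj ◁ ract ≫ ract
  ract_one : a.alg.one ▷ obj ≫ ract = (λ_ obj).hom
  act_comm : ract ▷ b.alg.obj ≫ lact =
    (α_ a.alg.obj obj b.alg.obj).hom ≫ a.alg.obj ◁ lact ≫ ract

/-- 2-morphisms of `B_eq`: bimodule maps. -/
@[ext]
structure BimoduleHom {a b : Beq B} (X Y : Bimodule a b) where
  hom : X.obj ⟶ Y.obj
  lact_hom : X.lact ≫ hom = hom ▷ b.alg.obj ≫ Y.lact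
  ract_hom : X.ract ≫ hom = a.alg.obj ◁ hom ≫ Y.ract

@[simps]
instance (a b : Beq B) : Category (Bimodule a b) where
  Hom X Y := BimoduleHom X Y
  id X := ⟨𝟙 X.obj, by simp, by simp⟩
  comp f g := ⟨f.hom ≫ g.hom, by
    rw [← Category.assoc, f.lact_hom, Category.assoc, g.lact_hom, comp_whiskerRight,
      Category.assoc], by
    rw [← Category.assoc, f.ract_hom, Category.assoc, g.ract_hom, whiskerLeft_comp,
      Category.assoc]⟩

namespace FrobeniusAlgebra
variable {a : B} (A : FrobeniusAlgebra a)
/-- The copairing `Δ ∘ η`. -/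
def copairing : 𝟙 a ⟶ A.obj ≫ A.obj := A.one ≫ A.comul

/-- The pairing `ε ∘ μ`. -/
def pairing : A.obj ≫ A.obj ⟶ 𝟙 a := A.mul ≫ A.counit

theorem copairing_left :
    (λ_ A.obj).inv ≫ A.copairing ▷ A.obj ≫ (α_ _ _ _).hom ≫ A.obj ◁ A.mul = A.comul := by
  simp only [copairing, comp_whiskerRight, Category.assoc]
  rw [A.frobenius_right, reassoc_of% A.one_mul]; simp
theorem copairing_right :
    (ρ_ A.obj).inv ≫ A.obj ◁ A.copairing ≫ (α_ _ _ _).inv ≫ A.mul ▷ A.obj = A.comul := by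
  simp only [copairing, whiskerLeft_comp, Category.assoc]
  rw [A.frobenius_left, reassoc_of% A.mul_one]; simp
theorem snake_left :
    (λ_ A.obj).inv ≫ A.copairing ▷ A.obj ≫ (α_ _ _ _).hom ≫ A.obj ◁ A.pairing
      ≫ (ρ_ A.obj).hom = 𝟙 _ := by
  simp only [pairing, whiskerLeft_comp, Category.assoc]
  rw [reassoc_of% A.copairing_left, reassoc_of% A.comul_counit]; simp
theorem snake_right :
    (ρ_ A.obj).inv ≫ A.obj ◁ A.copairing ≫ (α_ _ _ _).inv ≫ A.pairing ▷ A.obj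
      ≫ (λ_ A.obj).hom = 𝟙 _ := by
  simp only [pairing, comp_whiskerRight, Category.assoc]
  rw [reassoc_of% A.copairing_right, reassoc_of% A.counit_comul]; simp
theorem snake1 :
    A.copairing ▷ A.obj ⊗≫ A.obj ◁ A.pairing = 𝟙 _ ⊗≫ 𝟙 _ := by
  have h := congrArg (fun t => (λ_ A.obj).hom ≫ t ≫ (ρ_ A.obj).inv) A.snake_left
  refine Eq.trans ?_ (h.trans ?_) <;> bicategory

theorem snake2 :
    A.obj ◁ A.copairing ⊗≫ A.pairing ▷ A.obj = 𝟙 _ ⊗≫ 𝟙 _ := by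
  have h := congrArg (fun t => (ρ_ A.obj).hom ≫ t ≫ (λ_ A.obj).inv) A.snake_right
  refine Eq.trans ?_ (h.trans ?_) <;> bicategory

end FrobeniusAlgebra

theorem SepFrobeniusAlgebra.copairing_mul {a : B} (A : SepFrobeniusAlgebra a) :
    A.copairing ≫ A.mul = A.one := by
  simp [FrobeniusAlgebra.copairing, A.separable]

section Tensor
variable {a b c : Beq B} (X : Bimodule a b) (Y : Bimodule b c)

/-- The idempotent on `Y ⊗ X` whose image is `Y ⊗_B X`: insert `Δ ∘ η` of `B` between the two
factors and let its two legs act on the two neighbours. -/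
def tensorProj : X.obj ≫ Y.obj ⟶ X.obj ≫ Y.obj :=
  𝟙 _ ⊗≫ X.obj ◁ b.alg.copairing ▷ Y.obj ⊗≫ X.lact ▷ (b.alg.obj ≫ Y.obj) ⊗≫
    X.obj ◁ Y.ract ⊗≫ 𝟙 _

def sec : X.obj ≫ Y.obj ⟶ (X.obj ≫ b.alg.obj) ≫ Y.obj :=
  𝟙 _ ⊗≫ X.obj ◁ b.alg.copairing ▷ Y.obj ⊗≫ (X.obj ≫ b.alg.obj) ◁ Y.ract

theorem sec_l : sec X Y ≫ X.lact ▷ Y.obj = tensorProj X Y := by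
  have := whisker_exchange X.lact Y.ract
  simp only [sec, tensorProj]
  calc _ = 𝟙 _ ⊗≫ X.obj ◁ b.alg.copairing ▷ Y.obj ⊗≫ ((X.obj ≫ b.alg.obj) ◁ Y.ract ≫
        X.lact ▷ Y.obj) ⊗≫ 𝟙 _ := by bicategory
    _ = _ := by rw [this]; bicategory

theorem sec_r : sec X Y ≫ (α_ _ _ _).hom ≫ X.obj ◁ Y.ract = 𝟙 _ := by
  simp only [sec]
  calc _ = 𝟙 _ ⊗≫ X.obj ◁ (b.alg.copairing ▷ Y.obj ≫ (α_ _ _ _).hom ≫ b.alg.obj ◁ Y.ract ≫ Y.ract) := by bicategory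
    _ = _ := by
      rw [← Y.ract_assoc, FrobeniusAlgebra.copairing]
      simp only [comp_whiskerRight, Category.assoc]
      have := congrArg (· ▷ Y.obj) b.alg.separable
      simp only [comp_whiskerRight] at this
      rw [reassoc_of% this]
      simp only [id_whiskerRight, Category.id_comp, Y.ract_one]
      bicategory

theorem tensorProj_balanced :
    X.lact ▷ Y.obj ≫ tensorProj X Y = (α_ _ _ _).hom ≫ X.obj ◁ Y.ract ≫ tensorProj X Y := by
  have h1 : (ρ_ b.alg.obj).inv ≫ b.alg.obj ◁ b.alg.copairing ≫ (α_ _ _ _).inv ≫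
      b.alg.mul ▷ b.alg.obj = _ := b.alg.copairing_right.trans b.alg.copairing_left.symm
  calc _ = 𝟙 _ ⊗≫ (X.lact ▷ (𝟙 _ ≫ Y.obj) ≫ X.obj ◁ (b.alg.copairing ▷ Y.obj)) ⊗≫
          X.lact ▷ (b.alg.obj ≫ Y.obj) ⊗≫ X.obj ◁ Y.ract := by
        simp only [tensorProj]; bicategory
    _ = 𝟙 _ ⊗≫ (X.obj ≫ b.alg.obj) ◁ (b.alg.copairing ▷ Y.obj) ⊗≫
          (X.lact ▷ b.alg.obj ≫ X.lact) ▷ (b.alg.obj ≫ Y.obj) ⊗≫ X.obj ◁ Y.ract := by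
        rw [← whisker_exchange]; bicategory
    _ = 𝟙 _ ⊗≫ X.obj ◁ ((ρ_ b.alg.obj).inv ≫ b.alg.obj ◁ b.alg.copairing ≫ (α_ _ _ _).inv ≫
          b.alg.mul ▷ b.alg.obj) ▷ Y.obj ⊗≫ X.lact ▷ (b.alg.obj ≫ Y.obj) ⊗≫ X.obj ◁ Y.ract := by
        rw [X.lact_assoc]; bicategory
    _ = 𝟙 _ ⊗≫ X.obj ◁ b.alg.copairing ▷ (b.alg.obj ≫ Y.obj) ⊗≫
          ((X.obj ≫ b.alg.obj) ◁ (b.alg.mul ▷ Y.obj) ≫ X.lact ▷ (b.alg.obj ≫ Y.obj)) ⊗≫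
          X.obj ◁ Y.ract := by
        rw [h1]; bicategory
    _ = 𝟙 _ ⊗≫ X.obj ◁ b.alg.copairing ▷ (b.alg.obj ≫ Y.obj) ⊗≫
          X.lact ▷ ((b.alg.obj ≫ b.alg.obj) ≫ Y.obj) ⊗≫
          X.obj ◁ (b.alg.mul ▷ Y.obj ≫ Y.ract) := by
        rw [whisker_exchange]; bicategory
    _ = 𝟙 _ ⊗≫ X.obj ◁ b.alg.copairing ▷ (b.alg.obj ≫ Y.obj) ⊗≫
          (X.lact ▷ (b.alg.obj ≫ (b.alg.obj ≫ Y.obj)) ≫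
          X.obj ◁ (b.alg.obj ◁ Y.ract)) ⊗≫ X.obj ◁ Y.ract := by
        rw [Y.ract_assoc]; bicategory
    _ = 𝟙 _ ⊗≫ X.obj ◁ (b.alg.copairing ▷ (b.alg.obj ≫ Y.obj) ≫ (b.alg.obj ≫ b.alg.obj) ◁ Y.ract)
          ⊗≫
          (X.lact ▷ (b.alg.obj ≫ Y.obj)) ⊗≫ X.obj ◁ Y.ract := by
        rw [← whisker_exchange]; bicategory
    _ = _ := by
        rw [← whisker_exchange]; simp only [tensorProj]; bicategory


theorem tensorProj_comp {Z : a.base ⟶ c.base} (φ : X.obj ≫ Y.obj ⟶ Z)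
    (h : X.lact ▷ Y.obj ≫ φ = (α_ _ _ _).hom ≫ X.obj ◁ Y.ract ≫ φ) :
    tensorProj X Y ≫ φ = φ := by
  rw [← sec_l, Category.assoc, h]
  have := sec_r X Y
  simpa using this =≫ φ

theorem tensorProj_whiskerRight_comp {d : B} {W : c.base ⟶ d} {Z : a.base ⟶ d}
    (φ : (X.obj ≫ Y.obj) ≫ W ⟶ Z)
    (h : X.lact ▷ Y.obj ▷ W ≫ φ = ((α_ _ _ _).hom ≫ X.obj ◁ Y.ract) ▷ W ≫ φ) :
    tensorProj X Y ▷ W ≫ φ = φ := by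
  rw [← sec_l, comp_whiskerRight, Category.assoc, h, ← comp_whiskerRight_assoc, sec_r]
  simp

theorem tensorProj_whiskerLeft_comp {d : B} {W : d ⟶ a.base} {Z : d ⟶ c.base}
    (φ : W ≫ (X.obj ≫ Y.obj) ⟶ Z)
    (h : W ◁ (X.lact ▷ Y.obj) ≫ φ = W ◁ ((α_ _ _ _).hom ≫ X.obj ◁ Y.ract) ≫ φ) :
    W ◁ tensorProj X Y ≫ φ = φ := by
  rw [← sec_l, whiskerLeft_comp, Category.assoc, h, ← whiskerLeft_comp_assoc, sec_r]
  simp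

theorem tensorProj_idem : tensorProj X Y ≫ tensorProj X Y = tensorProj X Y :=
  tensorProj_comp X Y _ (tensorProj_balanced X Y)

variable [∀ x y : B, IsIdempotentComplete (x ⟶ y)]

/-- The relative tensor product: a chosen splitting of `tensorProj`. -/
noncomputable def tensorObj : a.base ⟶ c.base :=
  (IsIdempotentComplete.idempotents_split _ _ (tensorProj_idem X Y)).choose

noncomputable def xi0 : tensorObj X Y ⟶ X.obj ≫ Y.obj :=
  (IsIdempotentComplete.idempotents_split _ _ (tensorProj_idem X Y)).choose_spec.choose

noncomputable def theta0 : X.obj ≫ Y.obj ⟶ tensorObj X Y :=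
  (IsIdempotentComplete.idempotents_split _ _
    (tensorProj_idem X Y)).choose_spec.choose_spec.choose

@[simp]
theorem xi0_theta0 : xi0 X Y ≫ theta0 X Y = 𝟙 _ :=
  (IsIdempotentComplete.idempotents_split _ _
    (tensorProj_idem X Y)).choose_spec.choose_spec.choose_spec.1

theorem theta0_xi0 : theta0 X Y ≫ xi0 X Y = tensorProj X Y :=
  (IsIdempotentComplete.idempotents_split _ _
    (tensorProj_idem X Y)).choose_spec.choose_spec.choose_spec.2

theorem theta0_balanced :
    X.lact ▷ Y.obj ≫ theta0 X Y = (α_ _ _ _).hom ≫ X.obj ◁ Y.ract ≫ theta0 X Y := by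
  have h : theta0 X Y = tensorProj X Y ≫ theta0 X Y := by rw [← theta0_xi0]; simp
  rw [h, reassoc_of% tensorProj_balanced X Y]

theorem theta0_balanced' :
    X.obj ◁ Y.ract ≫ theta0 X Y = (α_ _ _ _).inv ≫ X.lact ▷ Y.obj ≫ theta0 X Y := by
  rw [theta0_balanced]; simp

theorem theta0_desc {Z : a.base ⟶ c.base} (φ : X.obj ≫ Y.obj ⟶ Z)
    (h : X.lact ▷ Y.obj ≫ φ = (α_ _ _ _).hom ≫ X.obj ◁ Y.ract ≫ φ) :
    theta0 X Y ≫ xi0 X Y ≫ φ = φ := by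
  rw [← Category.assoc, theta0_xi0, tensorProj_comp _ _ _ h]

theorem theta0_whiskerRight_desc {d : B} {W : c.base ⟶ d} {Z : a.base ⟶ d}
    (φ : (X.obj ≫ Y.obj) ≫ W ⟶ Z)
    (h : X.lact ▷ Y.obj ▷ W ≫ φ = ((α_ _ _ _).hom ≫ X.obj ◁ Y.ract) ▷ W ≫ φ) :
    theta0 X Y ▷ W ≫ xi0 X Y ▷ W ≫ φ = φ := by
  rw [← comp_whiskerRight_assoc, theta0_xi0, tensorProj_whiskerRight_comp _ _ _ h]

theorem theta0_whiskerLeft_desc {d : B} {W : d ⟶ a.base} {Z : d ⟶ c.base}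
    (φ : W ≫ (X.obj ≫ Y.obj) ⟶ Z)
    (h : W ◁ (X.lact ▷ Y.obj) ≫ φ = W ◁ ((α_ _ _ _).hom ≫ X.obj ◁ Y.ract) ≫ φ) :
    W ◁ theta0 X Y ≫ W ◁ xi0 X Y ≫ φ = φ := by
  rw [← whiskerLeft_comp_assoc, theta0_xi0, tensorProj_whiskerLeft_comp _ _ _ h]

instance : IsSplitEpi (theta0 X Y) := ⟨⟨⟨xi0 X Y, by simp⟩⟩⟩

instance splitEpi_whiskerRight {x y z : B} {f g : x ⟶ y} (t : f ⟶ g) [IsSplitEpi t] (W : y ⟶ z) :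
    IsSplitEpi (t ▷ W) := ⟨⟨⟨section_ t ▷ W, by rw [← comp_whiskerRight]; simp⟩⟩⟩
instance splitEpi_whiskerLeft {x y z : B} {f g : x ⟶ y} (t : f ⟶ g) [IsSplitEpi t] (W : z ⟶ x) :
    IsSplitEpi (W ◁ t) := ⟨⟨⟨W ◁ section_ t, by rw [← whiskerLeft_comp]; simp⟩⟩⟩

noncomputable def tensorLact : tensorObj X Y ≫ c.alg.obj ⟶ tensorObj X Y :=
  xi0 X Y ▷ c.alg.obj ≫ (α_ _ _ _).hom ≫ X.obj ◁ Y.lact ≫ theta0 X Y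

noncomputable def tensorRact : a.alg.obj ≫ tensorObj X Y ⟶ tensorObj X Y :=
  a.alg.obj ◁ xi0 X Y ≫ (α_ _ _ _).inv ≫ X.ract ▷ Y.obj ≫ theta0 X Y

theorem theta0_lact : theta0 X Y ▷ c.alg.obj ≫ tensorLact X Y =
    (α_ _ _ _).hom ≫ X.obj ◁ Y.lact ≫ theta0 X Y := by
  apply theta0_whiskerRight_desc
  calc _ = (α_ _ _ _).hom ≫ (X.lact ▷ (Y.obj ≫ c.alg.obj) ≫ X.obj ◁ Y.lact) ≫ theta0 X Y := by
        bicategory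
    _ = 𝟙 _ ⊗≫ (X.obj ≫ b.alg.obj) ◁ Y.lact ≫ X.lact ▷ Y.obj ≫ theta0 X Y := by
        rw [← whisker_exchange]; bicategory
    _ = 𝟙 _ ⊗≫ X.obj ◁ ((α_ b.alg.obj Y.obj c.alg.obj).hom ≫ b.alg.obj ◁ Y.lact ≫ Y.ract)
          ≫ theta0 X Y := by
        rw [theta0_balanced]; bicategory
    _ = _ := by
        rw [← Y.act_comm]; bicategory

theorem theta0_ract : a.alg.obj ◁ theta0 X Y ≫ tensorRact X Y =
    (α_ _ _ _).inv ≫ X.ract ▷ Y.obj ≫ theta0 X Y := by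
  refine theta0_whiskerLeft_desc X Y ((α_ _ _ _).inv ≫ X.ract ▷ Y.obj ≫ theta0 X Y) (Eq.symm ?_)
  calc _ = 𝟙 _ ⊗≫ ((a.alg.obj ≫ X.obj) ◁ Y.ract ≫ X.ract ▷ Y.obj) ⊗≫ theta0 X Y := by
        bicategory
    _ = 𝟙 _ ⊗≫ X.ract ▷ (b.alg.obj ≫ Y.obj) ≫ (X.obj ◁ Y.ract ≫ theta0 X Y) := by
        rw [whisker_exchange]; bicategory
    _ = 𝟙 _ ⊗≫ (X.ract ▷ b.alg.obj ≫ X.lact) ▷ Y.obj ≫ theta0 X Y := by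
        rw [theta0_balanced']; bicategory
    _ = a.alg.obj ◁ (X.lact ▷ Y.obj) ≫ (α_ _ _ _).inv ≫ X.ract ▷ Y.obj ≫ theta0 X Y := by
        rw [X.act_comm]; bicategory

noncomputable def tensor : Bimodule a c where
  obj := tensorObj X Y
  lact := tensorLact X Y
  ract := tensorRact X Y
  lact_assoc := by
    rw [← cancel_epi (theta0 X Y ▷ c.alg.obj ▷ c.alg.obj)]
    calc _ = (theta0 X Y ▷ c.alg.obj ≫ tensorLact X Y) ▷ c.alg.obj ≫ tensorLact X Y := by bicategory
      _ = ((α_ _ _ _).hom ≫ X.obj ◁ Y.lact) ▷ c.alg.obj ≫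
            theta0 X Y ▷ c.alg.obj ≫ tensorLact X Y := by
            conv_lhs => rw [theta0_lact]
            bicategory
      _ = 𝟙 _ ⊗≫ X.obj ◁ (Y.lact ▷ c.alg.obj ≫ Y.lact) ≫ theta0 X Y := by rw [theta0_lact]; bicategory
      _ = 𝟙 _ ⊗≫ (X.obj ≫ Y.obj) ◁ c.alg.mul ⊗≫ X.obj ◁ Y.lact ≫ theta0 X Y := by
            rw [Y.lact_assoc]; bicategory
      _ = 𝟙 _ ⊗≫ (X.obj ≫ Y.obj) ◁ c.alg.mul ≫ (theta0 X Y ▷ c.alg.obj ≫ tensorLact X Y) := by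
            rw [theta0_lact]; bicategory
      _ = 𝟙 _ ⊗≫ theta0 X Y ▷ (c.alg.obj ≫ c.alg.obj) ≫ tensorObj X Y ◁ c.alg.mul ≫
            tensorLact X Y := by rw [whisker_exchange_assoc]
      _ = _ := by bicategory
  lact_one := by
    rw [← cancel_epi (theta0 X Y ▷ 𝟙 _), ← whisker_exchange_assoc, theta0_lact]
    calc _ = 𝟙 _ ⊗≫ X.obj ◁ (Y.obj ◁ c.alg.one ≫ Y.lact) ≫ theta0 X Y := by bicategory
      _ = _ := by rw [Y.lact_one]; bicategory
  ract_assoc := by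
    rw [← cancel_epi ((a.alg.obj ≫ a.alg.obj) ◁ theta0 X Y)]
    symm
    calc _ = (α_ _ _ _).hom ≫ a.alg.obj ◁ (a.alg.obj ◁ theta0 X Y ≫ tensorRact X Y) ≫
            tensorRact X Y := by bicategory
      _ = (α_ _ _ _).hom ≫ a.alg.obj ◁ ((α_ _ _ _).inv ≫ X.ract ▷ Y.obj) ≫
            a.alg.obj ◁ theta0 X Y ≫ tensorRact X Y := by
            conv_lhs => rw [theta0_ract]
            bicategory
      _ = 𝟙 _ ⊗≫ ((α_ _ _ _).hom ≫ a.alg.obj ◁ X.ract ≫ X.ract) ▷ Y.obj ≫ theta0 X Y := by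
            rw [theta0_ract]; bicategory
      _ = 𝟙 _ ⊗≫ a.alg.mul ▷ (X.obj ≫ Y.obj) ⊗≫ X.ract ▷ Y.obj ≫ theta0 X Y := by
            rw [← X.ract_assoc]; bicategory
      _ = 𝟙 _ ⊗≫ a.alg.mul ▷ (X.obj ≫ Y.obj) ≫ (a.alg.obj ◁ theta0 X Y ≫ tensorRact X Y) := by
            rw [theta0_ract]; bicategory
      _ = 𝟙 _ ⊗≫ (a.alg.obj ≫ a.alg.obj) ◁ theta0 X Y ≫ a.alg.mul ▷ tensorObj X Y ≫
            tensorRact X Y := by rw [whisker_exchange_assoc]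
      _ = _ := by bicategory
  ract_one := by
    rw [← cancel_epi (𝟙 _ ◁ theta0 X Y), whisker_exchange_assoc, theta0_ract]
    calc _ = 𝟙 _ ⊗≫ (a.alg.one ▷ X.obj ≫ X.ract) ▷ Y.obj ≫ theta0 X Y := by bicategory
      _ = _ := by rw [X.ract_one]; bicategory
  act_comm := by
    rw [← cancel_epi ((a.alg.obj ◁ theta0 X Y) ▷ c.alg.obj)]
    calc _ = (a.alg.obj ◁ theta0 X Y ≫ tensorRact X Y) ▷ c.alg.obj ≫ tensorLact X Y := by bicategory
      _ = ((α_ _ _ _).inv ≫ X.ract ▷ Y.obj) ▷ c.alg.obj ≫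
            theta0 X Y ▷ c.alg.obj ≫ tensorLact X Y := by rw [theta0_ract]; bicategory
      _ = 𝟙 _ ⊗≫ (X.ract ▷ (Y.obj ≫ c.alg.obj) ≫ X.obj ◁ Y.lact) ≫ theta0 X Y := by
            rw [theta0_lact]; bicategory
      _ = 𝟙 _ ⊗≫ a.alg.obj ◁ (X.obj ◁ Y.lact) ≫ ((α_ _ _ _).inv ≫ X.ract ▷ Y.obj ≫
            theta0 X Y) := by
            rw [← whisker_exchange]; bicategory
      _ = 𝟙 _ ⊗≫ a.alg.obj ◁ (X.obj ◁ Y.lact ≫ theta0 X Y) ≫ tensorRact X Y := by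
            rw [← theta0_ract]; bicategory
      _ = 𝟙 _ ⊗≫ a.alg.obj ◁ ((α_ _ _ _).hom ≫ X.obj ◁ Y.lact ≫ theta0 X Y) ≫ tensorRact X Y := by
            bicategory
      _ = _ := by rw [← theta0_lact]; bicategory

/-- The splitting map `ξ : Y ⊗_B X → Y ⊗ X`. -/
noncomputable def ξ : (tensor X Y).obj ⟶ X.obj ≫ Y.obj := xi0 X Y

/-- The projection map `ϑ : Y ⊗ X → Y ⊗_B X`. -/
noncomputable def ϑ : X.obj ≫ Y.obj ⟶ (tensor X Y).obj := theta0 X Y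

@[simp]
theorem ξ_ϑ : ξ X Y ≫ ϑ X Y = 𝟙 _ := xi0_theta0 X Y

theorem ϑ_ξ : ϑ X Y ≫ ξ X Y = tensorProj X Y := theta0_xi0 X Y

instance : IsSplitEpi (ϑ X Y) := ⟨⟨⟨ξ X Y, by simp⟩⟩⟩

theorem ϑ_balanced :
    X.lact ▷ Y.obj ≫ ϑ X Y = (α_ _ _ _).hom ≫ X.obj ◁ Y.ract ≫ ϑ X Y := theta0_balanced X Y

theorem ϑ_balanced' :
    X.obj ◁ Y.ract ≫ ϑ X Y = (α_ _ _ _).inv ≫ X.lact ▷ Y.obj ≫ ϑ X Y := theta0_balanced' X Y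

theorem ϑ_desc {Z : a.base ⟶ c.base} (φ : X.obj ≫ Y.obj ⟶ Z)
    (h : X.lact ▷ Y.obj ≫ φ = (α_ _ _ _).hom ≫ X.obj ◁ Y.ract ≫ φ) :
    ϑ X Y ≫ ξ X Y ≫ φ = φ := theta0_desc X Y φ h

theorem ϑ_whiskerRight_desc {d : B} {W : c.base ⟶ d} {Z : a.base ⟶ d}
    (φ : (X.obj ≫ Y.obj) ≫ W ⟶ Z)
    (h : X.lact ▷ Y.obj ▷ W ≫ φ = ((α_ _ _ _).hom ≫ X.obj ◁ Y.ract) ▷ W ≫ φ) :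
    ϑ X Y ▷ W ≫ ξ X Y ▷ W ≫ φ = φ := theta0_whiskerRight_desc X Y φ h

theorem ϑ_whiskerLeft_desc {d : B} {W : d ⟶ a.base} {Z : d ⟶ c.base}
    (φ : W ≫ (X.obj ≫ Y.obj) ⟶ Z)
    (h : W ◁ (X.lact ▷ Y.obj) ≫ φ = W ◁ ((α_ _ _ _).hom ≫ X.obj ◁ Y.ract) ≫ φ) :
    W ◁ ϑ X Y ≫ W ◁ ξ X Y ≫ φ = φ := theta0_whiskerLeft_desc X Y φ h

theorem ϑ_lact : ϑ X Y ▷ c.alg.obj ≫ (tensor X Y).lact =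
    (α_ _ _ _).hom ≫ X.obj ◁ Y.lact ≫ ϑ X Y := theta0_lact X Y

theorem ϑ_ract : a.alg.obj ◁ ϑ X Y ≫ (tensor X Y).ract =
    (α_ _ _ _).inv ≫ X.ract ▷ Y.obj ≫ ϑ X Y := theta0_ract X Y

end Tensor


@[simp] theorem id_hom' {a b : Beq B} (X : Bimodule a b) : BimoduleHom.hom (𝟙 X) = 𝟙 X.obj := rfl
@[simp] theorem comp_hom' {a b : Beq B} {X Y Z : Bimodule a b} (f : X ⟶ Y) (g : Y ⟶ Z) :
    BimoduleHom.hom (f ≫ g) = f.hom ≫ g.hom := rfl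

@[ext] theorem hom_ext' {a b : Beq B} {X Y : Bimodule a b} (f g : X ⟶ Y) (h : f.hom = g.hom) :
    f = g := BimoduleHom.ext h

section Bicat
variable [∀ x y : B, IsIdempotentComplete (x ⟶ y)]
variable {a b c d : Beq B}

noncomputable def mapLeftHom (X : Bimodule a b) {Y Y' : Bimodule b c} (g : Y ⟶ Y') :
    (tensor X Y).obj ⟶ (tensor X Y').obj := ξ X Y ≫ X.obj ◁ g.hom ≫ ϑ X Y'

noncomputable def mapRightHom {X X' : Bimodule a b} (f : X ⟶ X') (Y : Bimodule b c) :
    (tensor X Y).obj ⟶ (tensor X' Y).obj := ξ X Y ≫ f.hom ▷ Y.obj ≫ ϑ X' Y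

theorem ϑ_mapLeft (X : Bimodule a b) {Y Y' : Bimodule b c} (g : Y ⟶ Y') :
    ϑ X Y ≫ mapLeftHom X g = X.obj ◁ g.hom ≫ ϑ X Y' := by
  apply ϑ_desc
  rw [← whisker_exchange_assoc, ϑ_balanced, ← whiskerLeft_comp_assoc, g.ract_hom]
  simp

theorem ϑ_mapRight {X X' : Bimodule a b} (f : X ⟶ X') (Y : Bimodule b c) :
    ϑ X Y ≫ mapRightHom f Y = f.hom ▷ Y.obj ≫ ϑ X' Y := by
  apply ϑ_desc
  rw [← comp_whiskerRight_assoc, f.lact_hom, whisker_exchange_assoc, ϑ_balanced']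
  simp

noncomputable def mapLeft (X : Bimodule a b) {Y Y' : Bimodule b c} (g : Y ⟶ Y') :
    tensor X Y ⟶ tensor X Y' where
  hom := mapLeftHom X g
  lact_hom := by
    rw [← cancel_epi (ϑ X Y ▷ c.alg.obj), reassoc_of% ϑ_lact, ϑ_mapLeft,
      ← comp_whiskerRight_assoc, ϑ_mapLeft, comp_whiskerRight_assoc, ϑ_lact,
      ← whiskerLeft_comp_assoc, g.lact_hom]
    simp
  ract_hom := by
    rw [← cancel_epi (a.alg.obj ◁ ϑ X Y), reassoc_of% ϑ_ract, ϑ_mapLeft,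
      ← whiskerLeft_comp_assoc, ϑ_mapLeft, whiskerLeft_comp_assoc, ϑ_ract,
      ← whisker_exchange_assoc]
    simp

noncomputable def mapRight {X X' : Bimodule a b} (f : X ⟶ X') (Y : Bimodule b c) :
    tensor X Y ⟶ tensor X' Y where
  hom := mapRightHom f Y
  lact_hom := by
    rw [← cancel_epi (ϑ X Y ▷ c.alg.obj), reassoc_of% ϑ_lact, ϑ_mapRight,
      ← comp_whiskerRight_assoc, ϑ_mapRight, comp_whiskerRight_assoc, ϑ_lact,
      whisker_exchange_assoc]
    simp
  ract_hom := by
    rw [← cancel_epi (a.alg.obj ◁ ϑ X Y), reassoc_of% ϑ_ract, ϑ_mapRight,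
      ← whiskerLeft_comp_assoc, ϑ_mapRight, whiskerLeft_comp_assoc, ϑ_ract,
      ← comp_whiskerRight_assoc, f.ract_hom]
    simp

variable (X : Bimodule a b) (Y : Bimodule b c) (Z : Bimodule c d)

theorem assoc_aux1 : X.lact ▷ (Y.obj ≫ Z.obj) ≫ X.obj ◁ ϑ Y Z ≫ ϑ X (tensor Y Z) =
    (α_ _ _ _).hom ≫ X.obj ◁ ((α_ _ _ _).inv ≫ Y.ract ▷ Z.obj ≫ ϑ Y Z) ≫ ϑ X (tensor Y Z) := by
  rw [← whisker_exchange_assoc, ϑ_balanced, ← ϑ_ract]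
  simp

theorem assoc_aux2 : (X.obj ≫ Y.obj) ◁ Z.ract ≫ ϑ X Y ▷ Z.obj ≫ ϑ (tensor X Y) Z =
    (α_ _ _ _).inv ≫ ((α_ _ _ _).hom ≫ X.obj ◁ Y.lact ≫ ϑ X Y) ▷ Z.obj ≫
      ϑ (tensor X Y) Z := by
  rw [whisker_exchange_assoc, ϑ_balanced', ← ϑ_lact]
  simp

theorem assoc_aux3 : ϑ X Y ▷ Z.obj ≫ ξ X Y ▷ Z.obj ≫ (α_ _ _ _).hom ≫ X.obj ◁ ϑ Y Z ≫
      ϑ X (tensor Y Z) = (α_ _ _ _).hom ≫ X.obj ◁ ϑ Y Z ≫ ϑ X (tensor Y Z) := by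
  apply ϑ_whiskerRight_desc
  have h := assoc_aux1 X Y Z
  calc _ = (α_ _ _ _).hom ≫ X.lact ▷ (Y.obj ≫ Z.obj) ≫ X.obj ◁ ϑ Y Z ≫ ϑ X (tensor Y Z) := by
        simp
    _ = _ := by rw [h]; bicategory

theorem assoc_aux4 : X.obj ◁ ϑ Y Z ≫ X.obj ◁ ξ Y Z ≫ (α_ _ _ _).inv ≫ ϑ X Y ▷ Z.obj ≫
      ϑ (tensor X Y) Z = (α_ _ _ _).inv ≫ ϑ X Y ▷ Z.obj ≫ ϑ (tensor X Y) Z := by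
  apply ϑ_whiskerLeft_desc
  have h := assoc_aux2 X Y Z
  symm
  calc _ = 𝟙 _ ⊗≫ (X.obj ≫ Y.obj) ◁ Z.ract ≫ ϑ X Y ▷ Z.obj ≫ ϑ (tensor X Y) Z := by
        bicategory
    _ = _ := by rw [h]; bicategory

noncomputable def assocHom : (tensor (tensor X Y) Z).obj ⟶ (tensor X (tensor Y Z)).obj :=
  ξ (tensor X Y) Z ≫ ξ X Y ▷ Z.obj ≫ (α_ _ _ _).hom ≫ X.obj ◁ ϑ Y Z ≫ ϑ X (tensor Y Z)

noncomputable def assocInv : (tensor X (tensor Y Z)).obj ⟶ (tensor (tensor X Y) Z).obj :=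
  ξ X (tensor Y Z) ≫ X.obj ◁ ξ Y Z ≫ (α_ _ _ _).inv ≫ ϑ X Y ▷ Z.obj ≫ ϑ (tensor X Y) Z

theorem ϑ_assocHom : ϑ X Y ▷ Z.obj ≫ ϑ (tensor X Y) Z ≫ assocHom X Y Z =
    (α_ _ _ _).hom ≫ X.obj ◁ ϑ Y Z ≫ ϑ X (tensor Y Z) := by
  rw [assocHom, ϑ_desc, assoc_aux3]
  rw [← cancel_epi (ϑ X Y ▷ c.alg.obj ▷ Z.obj), ← comp_whiskerRight_assoc, ϑ_lact]
  simp only [comp_whiskerRight, Category.assoc]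
  rw [assoc_aux3]
  rw [associator_naturality_left_assoc, ← whisker_exchange_assoc, assoc_aux3]
  calc _ = 𝟙 _ ⊗≫ X.obj ◁ (Y.lact ▷ Z.obj ≫ ϑ Y Z) ≫ ϑ X (tensor Y Z) := by bicategory
    _ = _ := by rw [ϑ_balanced]; bicategory

theorem ϑ_assocInv : X.obj ◁ ϑ Y Z ≫ ϑ X (tensor Y Z) ≫ assocInv X Y Z =
    (α_ _ _ _).inv ≫ ϑ X Y ▷ Z.obj ≫ ϑ (tensor X Y) Z := by
  rw [assocInv, ϑ_desc, assoc_aux4]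
  rw [← cancel_epi ((X.obj ≫ b.alg.obj) ◁ ϑ Y Z), whisker_exchange_assoc, assoc_aux4]
  symm
  calc _ = 𝟙 _ ⊗≫ X.obj ◁ (b.alg.obj ◁ ϑ Y Z ≫ (tensor Y Z).ract) ≫ X.obj ◁ ξ Y Z ≫
          (α_ _ _ _).inv ≫ ϑ X Y ▷ Z.obj ≫ ϑ (tensor X Y) Z := by bicategory
    _ = 𝟙 _ ⊗≫ X.obj ◁ (Y.ract ▷ Z.obj) ≫ (X.obj ◁ ϑ Y Z ≫ X.obj ◁ ξ Y Z ≫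
          (α_ _ _ _).inv ≫ ϑ X Y ▷ Z.obj ≫ ϑ (tensor X Y) Z) := by rw [ϑ_ract]; bicategory
    _ = 𝟙 _ ⊗≫ (X.obj ◁ Y.ract ≫ ϑ X Y) ▷ Z.obj ≫ ϑ (tensor X Y) Z := by
          rw [assoc_aux4]; bicategory
    _ = _ := by rw [ϑ_balanced']; bicategory

noncomputable def assocBimodHom : tensor (tensor X Y) Z ⟶ tensor X (tensor Y Z) where
  hom := assocHom X Y Z
  lact_hom := by
    rw [← cancel_epi (ϑ (tensor X Y) Z ▷ d.alg.obj), reassoc_of% ϑ_lact,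
      ← cancel_epi ((ϑ X Y ▷ Z.obj) ▷ d.alg.obj)]
    symm
    calc _ = (ϑ X Y ▷ Z.obj ≫ ϑ (tensor X Y) Z ≫ assocHom X Y Z) ▷ d.alg.obj ≫
              (tensor X (tensor Y Z)).lact := by bicategory
      _ = ((α_ _ _ _).hom ≫ X.obj ◁ ϑ Y Z) ▷ d.alg.obj ≫
            ϑ X (tensor Y Z) ▷ d.alg.obj ≫ (tensor X (tensor Y Z)).lact := by
            rw [ϑ_assocHom]; bicategory
      _ = 𝟙 _ ⊗≫ X.obj ◁ (ϑ Y Z ▷ d.alg.obj ≫ (tensor Y Z).lact) ≫ ϑ X (tensor Y Z) := by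
            rw [ϑ_lact]; bicategory
      _ = 𝟙 _ ⊗≫ (X.obj ≫ Y.obj) ◁ Z.lact ≫ ((α_ _ _ _).hom ≫ X.obj ◁ ϑ Y Z ≫
            ϑ X (tensor Y Z)) := by rw [ϑ_lact]; bicategory
      _ = 𝟙 _ ⊗≫ ((X.obj ≫ Y.obj) ◁ Z.lact ≫ ϑ X Y ▷ Z.obj) ≫ ϑ (tensor X Y) Z ≫
            assocHom X Y Z := by rw [← ϑ_assocHom]; bicategory
      _ = _ := by rw [whisker_exchange]; bicategory
  ract_hom := by
    rw [← cancel_epi (a.alg.obj ◁ ϑ (tensor X Y) Z), reassoc_of% ϑ_ract,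
      ← cancel_epi (a.alg.obj ◁ (ϑ X Y ▷ Z.obj))]
    symm
    calc _ = a.alg.obj ◁ (ϑ X Y ▷ Z.obj ≫ ϑ (tensor X Y) Z ≫ assocHom X Y Z) ≫
              (tensor X (tensor Y Z)).ract := by bicategory
      _ = 𝟙 _ ⊗≫ a.alg.obj ◁ (X.obj ◁ ϑ Y Z) ⊗≫
            (a.alg.obj ◁ ϑ X (tensor Y Z) ≫ (tensor X (tensor Y Z)).ract) := by
            rw [ϑ_assocHom]; bicategory
      _ = 𝟙 _ ⊗≫ ((a.alg.obj ≫ X.obj) ◁ ϑ Y Z ≫ X.ract ▷ (tensor Y Z).obj) ≫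
            ϑ X (tensor Y Z) := by
            rw [ϑ_ract]; bicategory
      _ = 𝟙 _ ⊗≫ X.ract ▷ Y.obj ▷ Z.obj ≫ ((α_ _ _ _).hom ≫ X.obj ◁ ϑ Y Z ≫
            ϑ X (tensor Y Z)) := by rw [whisker_exchange]; bicategory
      _ = 𝟙 _ ⊗≫ ((α_ _ _ _).inv ≫ X.ract ▷ Y.obj ≫ ϑ X Y) ▷ Z.obj ≫ ϑ (tensor X Y) Z ≫
            assocHom X Y Z := by rw [← ϑ_assocHom]; bicategory
      _ = _ := by rw [← ϑ_ract]; bicategory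

theorem assocHom_inv : assocHom X Y Z ≫ assocInv X Y Z = 𝟙 _ := by
  rw [← cancel_epi (ϑ (tensor X Y) Z), ← cancel_epi (ϑ X Y ▷ Z.obj), reassoc_of% ϑ_assocHom,
      ϑ_assocInv]
  simp

theorem assocInv_hom : assocInv X Y Z ≫ assocHom X Y Z = 𝟙 _ := by
  rw [← cancel_epi (ϑ X (tensor Y Z)), ← cancel_epi (X.obj ◁ ϑ Y Z), reassoc_of% ϑ_assocInv,
      ϑ_assocHom]
  simp

/-- A bimodule map whose underlying 2-morphism is invertible is an isomorphism. -/
def isoOfHom {X Y : Bimodule a b} (f : X ⟶ Y) (g : Y.obj ⟶ X.obj)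
    (h₁ : f.hom ≫ g = 𝟙 _) (h₂ : g ≫ f.hom = 𝟙 _) : X ≅ Y where
  hom := f
  inv :=
    { hom := g
      lact_hom := by
        have := f.lact_hom
        calc _ = (g ≫ f.hom) ▷ b.alg.obj ≫ Y.lact ≫ g := by rw [h₂]; simp
          _ = g ▷ b.alg.obj ≫ (f.hom ▷ b.alg.obj ≫ Y.lact) ≫ g := by simp
          _ = g ▷ b.alg.obj ≫ X.lact ≫ (f.hom ≫ g) := by rw [← f.lact_hom]; simp
          _ = _ := by rw [h₁]; simp
      ract_hom := by
        calc _ = a.alg.obj ◁ (g ≫ f.hom) ≫ Y.ract ≫ g := by rw [h₂]; simp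
          _ = a.alg.obj ◁ g ≫ (a.alg.obj ◁ f.hom ≫ Y.ract) ≫ g := by simp
          _ = a.alg.obj ◁ g ≫ X.ract ≫ (f.hom ≫ g) := by rw [← f.ract_hom]; simp
          _ = _ := by rw [h₁]; simp }
  hom_inv_id := hom_ext' _ _ h₁
  inv_hom_id := hom_ext' _ _ h₂

noncomputable def assocIso : tensor (tensor X Y) Z ≅ tensor X (tensor Y Z) :=
  isoOfHom (assocBimodHom X Y Z) (assocInv X Y Z) (assocHom_inv X Y Z) (assocInv_hom X Y Z)

def unit (a : Beq B) : Bimodule a a where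
  obj := a.alg.obj
  lact := a.alg.mul
  ract := a.alg.mul
  lact_assoc := a.alg.mul_assoc
  lact_one := a.alg.mul_one
  ract_assoc := a.alg.mul_assoc
  ract_one := a.alg.one_mul
  act_comm := a.alg.mul_assoc

/-- `ϑ` for the tensor product `X ⊗_A A`. -/
noncomputable def ϑr : a.alg.obj ≫ X.obj ⟶ (tensor (unit a) X).obj := ϑ (unit a) X

/-- `ϑ` for the tensor product `B ⊗_B X`. -/
noncomputable def ϑl : X.obj ≫ b.alg.obj ⟶ (tensor X (unit b)).obj := ϑ X (unit b)

noncomputable def ξr : (tensor (unit a) X).obj ⟶ a.alg.obj ≫ X.obj := ξ (unit a) X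

noncomputable def ξl : (tensor X (unit b)).obj ⟶ X.obj ≫ b.alg.obj := ξ X (unit b)

instance : IsSplitEpi (ϑr X) := inferInstanceAs (IsSplitEpi (ϑ (unit a) X))
instance : IsSplitEpi (ϑl X) := inferInstanceAs (IsSplitEpi (ϑ X (unit b)))

theorem ϑr_balanced : a.alg.obj ◁ X.ract ≫ ϑr X =
    (α_ _ _ _).inv ≫ a.alg.mul ▷ X.obj ≫ ϑr X := ϑ_balanced' (unit a) X

theorem ϑl_balanced : X.lact ▷ b.alg.obj ≫ ϑl X =
    (α_ _ _ _).hom ≫ X.obj ◁ b.alg.mul ≫ ϑl X := ϑ_balanced X (unit b)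

theorem ϑr_lact : ϑr X ▷ b.alg.obj ≫ (tensor (unit a) X).lact =
    (α_ _ _ _).hom ≫ a.alg.obj ◁ X.lact ≫ ϑr X := ϑ_lact (unit a) X

theorem ϑr_ract : a.alg.obj ◁ ϑr X ≫ (tensor (unit a) X).ract =
    (α_ _ _ _).inv ≫ a.alg.mul ▷ X.obj ≫ ϑr X := ϑ_ract (unit a) X

theorem ϑl_lact : ϑl X ▷ b.alg.obj ≫ (tensor X (unit b)).lact =
    (α_ _ _ _).hom ≫ X.obj ◁ b.alg.mul ≫ ϑl X := ϑ_lact X (unit b)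

theorem ϑl_ract : a.alg.obj ◁ ϑl X ≫ (tensor X (unit b)).ract =
    (α_ _ _ _).inv ≫ X.ract ▷ b.alg.obj ≫ ϑl X := ϑ_ract X (unit b)

noncomputable def unitRactHom : (tensor (unit a) X).obj ⟶ X.obj := ξr X ≫ X.ract

noncomputable def unitRactInv : X.obj ⟶ (tensor (unit a) X).obj :=
  𝟙 _ ⊗≫ a.alg.copairing ▷ X.obj ⊗≫ a.alg.obj ◁ X.ract ≫ ϑr X

noncomputable def unitLactHom : (tensor X (unit b)).obj ⟶ X.obj := ξl X ≫ X.lact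

noncomputable def unitLactInv : X.obj ⟶ (tensor X (unit b)).obj :=
  𝟙 _ ⊗≫ X.obj ◁ b.alg.copairing ⊗≫ X.lact ▷ b.alg.obj ≫ ϑl X

theorem ϑ_unitRactHom : ϑr X ≫ unitRactHom X = X.ract :=
  ϑ_desc (unit a) X X.ract X.ract_assoc

theorem ϑ_unitLactHom : ϑl X ≫ unitLactHom X = X.lact :=
  ϑ_desc X (unit b) X.lact X.lact_assoc

theorem unitRactInv_eq : unitRactInv X = (λ_ _).inv ≫ a.alg.one ▷ X.obj ≫ ϑr X := by
  rw [unitRactInv, ϑr_balanced, ← SepFrobeniusAlgebra.copairing_mul]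
  bicategory

theorem unitLactInv_eq : unitLactInv X = (ρ_ _).inv ≫ X.obj ◁ b.alg.one ≫ ϑl X := by
  rw [unitLactInv, ϑl_balanced, ← SepFrobeniusAlgebra.copairing_mul]
  bicategory

noncomputable def unitRactBimodHom : tensor (unit a) X ⟶ X where
  hom := unitRactHom X
  lact_hom := by
    rw [← cancel_epi (ϑr X ▷ b.alg.obj), reassoc_of% ϑr_lact, ϑ_unitRactHom,
      ← comp_whiskerRight_assoc, ϑ_unitRactHom, X.act_comm]
  ract_hom := by
    rw [← cancel_epi (a.alg.obj ◁ ϑr X), reassoc_of% ϑr_ract, ϑ_unitRactHom,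
      ← whiskerLeft_comp_assoc, ϑ_unitRactHom, X.ract_assoc, Iso.inv_hom_id_assoc]

noncomputable def unitLactBimodHom : tensor X (unit b) ⟶ X where
  hom := unitLactHom X
  lact_hom := by
    rw [← cancel_epi (ϑl X ▷ b.alg.obj), reassoc_of% ϑl_lact, ϑ_unitLactHom,
      ← comp_whiskerRight_assoc, ϑ_unitLactHom, X.lact_assoc]
  ract_hom := by
    rw [← cancel_epi (a.alg.obj ◁ ϑl X), reassoc_of% ϑl_ract, ϑ_unitLactHom,
      ← whiskerLeft_comp_assoc, ϑ_unitLactHom, X.act_comm, Iso.inv_hom_id_assoc]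

theorem unitRact_hom_inv : unitRactHom X ≫ unitRactInv X = 𝟙 _ := by
  rw [← cancel_epi (ϑr X), reassoc_of% ϑ_unitRactHom, unitRactInv_eq]
  calc _ = 𝟙 _ ⊗≫ (𝟙 _ ◁ X.ract ≫ a.alg.one ▷ X.obj) ≫ ϑr X := by bicategory
    _ = 𝟙 _ ⊗≫ (a.alg.one ▷ a.alg.obj ≫ a.alg.mul) ▷ X.obj ≫ ϑr X := by
        rw [whisker_exchange, Category.assoc, ϑr_balanced]; bicategory
    _ = _ := by rw [a.alg.one_mul]; bicategory

theorem unitRact_inv_hom : unitRactInv X ≫ unitRactHom X = 𝟙 _ := by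
  rw [unitRactInv_eq, Category.assoc, Category.assoc, ϑ_unitRactHom, X.ract_one]
  simp

theorem unitLact_hom_inv : unitLactHom X ≫ unitLactInv X = 𝟙 _ := by
  rw [← cancel_epi (ϑl X), reassoc_of% ϑ_unitLactHom, unitLactInv_eq]
  calc _ = 𝟙 _ ⊗≫ (X.lact ▷ 𝟙 _ ≫ X.obj ◁ b.alg.one) ≫ ϑl X := by bicategory
    _ = 𝟙 _ ⊗≫ X.obj ◁ (b.alg.obj ◁ b.alg.one ≫ b.alg.mul) ≫ ϑl X := by
        rw [← whisker_exchange, Category.assoc, ϑl_balanced]; bicategory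
    _ = _ := by rw [b.alg.mul_one]; bicategory

theorem unitLact_inv_hom : unitLactInv X ≫ unitLactHom X = 𝟙 _ := by
  rw [unitLactInv_eq, Category.assoc, Category.assoc, ϑ_unitLactHom, X.lact_one]
  simp

noncomputable def unitRactIso : tensor (unit a) X ≅ X :=
  isoOfHom (unitRactBimodHom X) (unitRactInv X) (unitRact_hom_inv X) (unitRact_inv_hom X)

noncomputable def unitLactIso : tensor X (unit b) ≅ X :=
  isoOfHom (unitLactBimodHom X) (unitLactInv X) (unitLact_hom_inv X) (unitLact_inv_hom X)

@[simp] theorem mapLeft_hom (X : Bimodule a b) {Y Y' : Bimodule b c} (g : Y ⟶ Y') :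
    (mapLeft X g).hom = mapLeftHom X g := rfl
@[simp] theorem mapRight_hom {X X' : Bimodule a b} (f : X ⟶ X') (Y : Bimodule b c) :
    (mapRight f Y).hom = mapRightHom f Y := rfl
@[simp] theorem assocIso_hom_hom : (assocIso X Y Z).hom.hom = assocHom X Y Z := rfl
@[simp] theorem assocIso_inv_hom : (assocIso X Y Z).inv.hom = assocInv X Y Z := rfl
@[simp] theorem unitRactIso_hom_hom : (unitRactIso X).hom.hom = unitRactHom X := rfl
@[simp] theorem unitRactIso_inv_hom : (unitRactIso X).inv.hom = unitRactInv X := rfl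
@[simp] theorem unitLactIso_hom_hom : (unitLactIso X).hom.hom = unitLactHom X := rfl
@[simp] theorem unitLactIso_inv_hom : (unitLactIso X).inv.hom = unitLactInv X := rfl


theorem ϑr_map {X Y : Bimodule a b} (f : X ⟶ Y) :
    ϑr X ≫ mapLeftHom (unit a) f = a.alg.obj ◁ f.hom ≫ ϑr Y := ϑ_mapLeft (unit a) f

theorem ϑl_map {X Y : Bimodule a b} (f : X ⟶ Y) :
    ϑl X ≫ mapRightHom f (unit b) = f.hom ▷ b.alg.obj ≫ ϑl Y := ϑ_mapRight f (unit b)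

theorem ϑl_assocHom (Y : Bimodule b c) :
    ϑl X ▷ Y.obj ≫ ϑ (tensor X (unit b)) Y ≫ assocHom X (unit b) Y =
      (α_ _ _ _).hom ≫ X.obj ◁ ϑr Y ≫ ϑ X (tensor (unit b) Y) := ϑ_assocHom X (unit b) Y

theorem comp_mapLeft {Z Z' : Bimodule c d} (f : Z ⟶ Z') :
    mapLeftHom (tensor X Y) f ≫ assocHom X Y Z' =
      assocHom X Y Z ≫ mapLeftHom X (mapLeft Y f) := by
  rw [← cancel_epi (ϑ (tensor X Y) Z), ← cancel_epi (ϑ X Y ▷ Z.obj), reassoc_of% ϑ_assocHom,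
    ϑ_mapLeft, reassoc_of% ϑ_mapLeft, mapLeft_hom, ← whiskerLeft_comp_assoc, ϑ_mapLeft,
    ← whisker_exchange_assoc, ϑ_assocHom]
  simp

theorem mapLeft_assoc {Y Y' : Bimodule b c} (g : Y ⟶ Y') :
    mapRightHom (mapLeft X g) Z ≫ assocHom X Y' Z =
      assocHom X Y Z ≫ mapLeftHom X (mapRight g Z) := by
  rw [← cancel_epi (ϑ (tensor X Y) Z), ← cancel_epi (ϑ X Y ▷ Z.obj), reassoc_of% ϑ_assocHom,
    ϑ_mapLeft, reassoc_of% ϑ_mapRight, mapLeft_hom, mapRight_hom, ← whiskerLeft_comp_assoc,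
    ϑ_mapRight, ← comp_whiskerRight_assoc, ϑ_mapLeft, comp_whiskerRight_assoc, ϑ_assocHom]
  simp

theorem mapRight_comp {X X' : Bimodule a b} (f : X ⟶ X') :
    mapRightHom (mapRight f Y) Z ≫ assocHom X' Y Z =
      assocHom X Y Z ≫ mapRightHom f (tensor Y Z) := by
  rw [← cancel_epi (ϑ (tensor X Y) Z), ← cancel_epi (ϑ X Y ▷ Z.obj), reassoc_of% ϑ_assocHom,
    ϑ_mapRight, reassoc_of% ϑ_mapRight, mapRight_hom, ← comp_whiskerRight_assoc, ϑ_mapRight,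
    comp_whiskerRight_assoc, ϑ_assocHom, whisker_exchange_assoc]
  simp

theorem map_exchange {X X' : Bimodule a b} {Y Y' : Bimodule b c} (f : X ⟶ X') (g : Y ⟶ Y') :
    mapLeftHom X g ≫ mapRightHom f Y' = mapRightHom f Y ≫ mapLeftHom X' g := by
  rw [← cancel_epi (ϑ X Y), reassoc_of% ϑ_mapLeft, ϑ_mapRight, reassoc_of% ϑ_mapRight, ϑ_mapLeft,
    whisker_exchange_assoc]

theorem map_pentagon {e : Beq B} (W : Bimodule d e) :
    mapRightHom (assocIso X Y Z).hom W ≫ assocHom X (tensor Y Z) W ≫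
        mapLeftHom X (assocIso Y Z W).hom =
      assocHom (tensor X Y) Z W ≫ assocHom X Y (tensor Z W) := by
  rw [← cancel_epi (ϑ (tensor (tensor X Y) Z) W),
    ← cancel_epi (ϑ (tensor X Y) Z ▷ W.obj), ← cancel_epi (ϑ X Y ▷ Z.obj ▷ W.obj)]
  rw [reassoc_of% ϑ_assocHom, reassoc_of% ϑ_mapRight, assocIso_hom_hom]
  calc _ = (ϑ X Y ▷ Z.obj ≫ ϑ (tensor X Y) Z ≫ assocHom X Y Z) ▷ W.obj ≫
          ϑ (tensor X (tensor Y Z)) W ≫ assocHom X (tensor Y Z) W ≫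
            mapLeftHom X (assocIso Y Z W).hom := by simp
    _ = 𝟙 _ ⊗≫ (X.obj ◁ ϑ Y Z) ▷ W.obj ≫ (ϑ X (tensor Y Z) ▷ W.obj ≫
          ϑ (tensor X (tensor Y Z)) W ≫ assocHom X (tensor Y Z) W ≫
            mapLeftHom X (assocIso Y Z W).hom) := by
        rw [ϑ_assocHom]; bicategory
    _ = 𝟙 _ ⊗≫ X.obj ◁ (ϑ Y Z ▷ W.obj ≫ ϑ (tensor Y Z) W ≫ assocHom Y Z W) ≫
          ϑ X (tensor Y (tensor Z W)) := by
        rw [reassoc_of% ϑ_assocHom, ϑ_mapLeft, assocIso_hom_hom]; bicategory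
    _ = 𝟙 _ ⊗≫ (X.obj ≫ Y.obj) ◁ ϑ Z W ≫ ((α_ _ _ _).hom ≫ X.obj ◁ ϑ Y (tensor Z W) ≫
          ϑ X (tensor Y (tensor Z W))) := by
        rw [ϑ_assocHom]; bicategory
    _ = 𝟙 _ ⊗≫ ((X.obj ≫ Y.obj) ◁ ϑ Z W ≫ ϑ X Y ▷ (tensor Z W).obj) ≫
          ϑ (tensor X Y) (tensor Z W) ≫ assocHom X Y (tensor Z W) := by
        rw [← ϑ_assocHom]; bicategory
    _ = _ := by
        rw [whisker_exchange]; bicategory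

theorem map_triangle (Y : Bimodule b c) :
    assocHom X (unit b) Y ≫ mapLeftHom X (unitRactIso Y).hom =
      mapRightHom (unitLactIso X).hom Y := by
  rw [← cancel_epi (ϑ (tensor X (unit b)) Y), ← cancel_epi (ϑl X ▷ Y.obj), reassoc_of% ϑl_assocHom,
    ϑ_mapLeft, ϑ_mapRight, unitRactIso_hom_hom, unitLactIso_hom_hom, ← whiskerLeft_comp_assoc,
    ϑ_unitRactHom, ← comp_whiskerRight_assoc, ϑ_unitLactHom, ϑ_balanced]

/-- The equivariant completion `B_eq`. Composition of 1-morphisms is the relative tensor product,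
and the unit 1-morphism of `(a, A)` is `A` as a bimodule over itself. -/
noncomputable instance : Bicategory (Beq B) where
  Hom a b := Bimodule a b
  id a := unit a
  comp X Y := tensor X Y
  homCategory a b := inferInstanceAs (Category (Bimodule a b))
  whiskerLeft X _ _ g := mapLeft X g
  whiskerRight f Y := mapRight f Y
  associator X Y Z := assocIso X Y Z
  leftUnitor X := unitRactIso X
  rightUnitor X := unitLactIso X
  whiskerLeft_id X Y := by
    apply hom_ext'
    simp only [mapLeft_hom, id_hom', ← cancel_epi (ϑ X Y), ϑ_mapLeft]
    simp
  whiskerLeft_comp X Y Y' Y'' f g := by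
    apply hom_ext'
    simp only [mapLeft_hom, comp_hom', ← cancel_epi (ϑ X _), ϑ_mapLeft, reassoc_of% ϑ_mapLeft]
    simp
  id_whiskerLeft {a b X Y} f := by
    apply hom_ext'
    change mapLeftHom (unit a) f = unitRactHom X ≫ f.hom ≫ unitRactInv Y
    rw [← cancel_epi (ϑr X), reassoc_of% ϑ_unitRactHom, ϑr_map, ← Category.assoc X.ract, f.ract_hom,
      Category.assoc, ← ϑ_unitRactHom Y, Category.assoc, unitRact_hom_inv, Category.comp_id]
  comp_whiskerLeft X Y Z Z' f := by
    apply hom_ext'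
    change mapLeftHom (tensor X Y) f =
      assocHom X Y Z ≫ mapLeftHom X (mapLeft Y f) ≫ assocInv X Y Z'
    rw [← Category.assoc, ← comp_mapLeft, Category.assoc, assocHom_inv, Category.comp_id]
  id_whiskerRight X Y := by
    apply hom_ext'
    simp only [mapRight_hom, id_hom', ← cancel_epi (ϑ X Y), ϑ_mapRight]
    simp
  comp_whiskerRight f g Y := by
    apply hom_ext'
    simp only [mapRight_hom, comp_hom', ← cancel_epi (ϑ _ Y), ϑ_mapRight, reassoc_of% ϑ_mapRight]
    simp
  whiskerRight_id {a b X Y} f := by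
    apply hom_ext'
    change mapRightHom f (unit b) = unitLactHom X ≫ f.hom ≫ unitLactInv Y
    rw [← cancel_epi (ϑl X), reassoc_of% ϑ_unitLactHom, ϑl_map, ← Category.assoc X.lact, f.lact_hom,
      Category.assoc, ← ϑ_unitLactHom Y, Category.assoc, unitLact_hom_inv, Category.comp_id]
  whiskerRight_comp {a b c d X X'} f Y Z := by
    apply hom_ext'
    change mapRightHom f (tensor Y Z) =
      assocInv X Y Z ≫ mapRightHom (mapRight f Y) Z ≫ assocHom X' Y Z
    rw [mapRight_comp, ← Category.assoc, assocInv_hom, Category.id_comp]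
  whisker_assoc X Y Y' g Z := by
    apply hom_ext'
    change mapRightHom (mapLeft X g) Z =
      assocHom X Y Z ≫ mapLeftHom X (mapRight g Z) ≫ assocInv X Y' Z
    rw [← Category.assoc, ← mapLeft_assoc, Category.assoc, assocHom_inv, Category.comp_id]
  whisker_exchange f g := hom_ext' _ _ (map_exchange f g)
  pentagon X Y Z W := hom_ext' _ _ (map_pentagon X Y Z W)
  triangle X Y := hom_ext' _ _ (map_triangle X Y)

end Bicat
/-- A pivotal bicategory: every 1-morphism `X` has a chosen 1-morphism `X†` which is both a left
and a right adjoint of `X`, with chosen adjunctions, such that the two duals `X† ⟶ Z†` of every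
2-morphism `φ : Z ⟶ X` agree and the two canonical maps `(Y ⊗ X)† ⟶ X† ⊗ Y†` agree. -/
class PivotalBicategory (B : Type u) [Bicategory.{w, v} B] where
  dual {a b : B} (X : a ⟶ b) : b ⟶ a
  leftAdj {a b : B} (X : a ⟶ b) : dual X ⊣ X
  rightAdj {a b : B} (X : a ⟶ b) : X ⊣ dual X
  pivotal_map {a b : B} {Z X : a ⟶ b} (φ : Z ⟶ X) :
    (𝟙 _ ⊗≫ dual X ◁ (rightAdj Z).unit ⊗≫ dual X ◁ φ ▷ dual Z ⊗≫
      (rightAdj X).counit ▷ dual Z ⊗≫ 𝟙 _ : dual X ⟶ dual Z) =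
    𝟙 _ ⊗≫ (leftAdj Z).unit ▷ dual X ⊗≫ dual Z ◁ φ ▷ dual X ⊗≫
      dual Z ◁ (leftAdj X).counit ⊗≫ 𝟙 _
  pivotal_comp {a b c : B} (X : a ⟶ b) (Y : b ⟶ c) :
    (𝟙 _ ⊗≫ dual (X ≫ Y) ◁ (rightAdj X).unit ⊗≫
      dual (X ≫ Y) ◁ X ◁ (rightAdj Y).unit ▷ dual X ⊗≫
      (rightAdj (X ≫ Y)).counit ▷ (dual Y ≫ dual X) ⊗≫ 𝟙 _ :
        dual (X ≫ Y) ⟶ dual Y ≫ dual X) =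
    𝟙 _ ⊗≫ (leftAdj Y).unit ▷ dual (X ≫ Y) ⊗≫
      dual Y ◁ (leftAdj X).unit ▷ Y ▷ dual (X ≫ Y) ⊗≫
      (dual Y ≫ dual X) ◁ (leftAdj (X ≫ Y)).counit ⊗≫ 𝟙 _

section Pivotal
open PivotalBicategory
variable [PivotalBicategory B]

postfix:max "†" => PivotalBicategory.dual

section
variable {a b c : B} (X : a ⟶ b) (Y : b ⟶ c)

/-- `ev_X : X† ⊗ X → I` of the adjunction `X† ⊣ X`. -/
abbrev ev : X ≫ X† ⟶ 𝟙 a := (leftAdj X).counit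
/-- `coev_X : I → X ⊗ X†` of the adjunction `X† ⊣ X`. -/
abbrev coev : 𝟙 b ⟶ X† ≫ X := (leftAdj X).unit
/-- The tilded evaluation `X ⊗ X† → I` of the adjunction `X ⊣ X†`. -/
abbrev tev : X† ≫ X ⟶ 𝟙 b := (rightAdj X).counit
/-- The tilded coevaluation `I → X† ⊗ X` of the adjunction `X ⊣ X†`. -/
abbrev tcoev : 𝟙 a ⟶ X ≫ X† := (rightAdj X).unit

theorem z1 : coev X ▷ X† ⊗≫ X† ◁ ev X = 𝟙 _ ⊗≫ 𝟙 _ := by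
  have := (leftAdj X).left_triangle
  simp only [leftZigzag] at this
  rw [this]; bicategory
theorem z2 : X ◁ coev X ⊗≫ ev X ▷ X = 𝟙 _ ⊗≫ 𝟙 _ := by
  have := (leftAdj X).right_triangle
  simp only [rightZigzag] at this
  rw [this]; bicategory
theorem z3 : tcoev X ▷ X ⊗≫ X ◁ tev X = 𝟙 _ ⊗≫ 𝟙 _ := by
  have := (rightAdj X).left_triangle
  simp only [leftZigzag] at this
  rw [this]; bicategory
theorem z4 : X† ◁ tcoev X ⊗≫ tev X ▷ X† = 𝟙 _ ⊗≫ 𝟙 _ := by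
  have := (rightAdj X).right_triangle
  simp only [rightZigzag] at this
  rw [this]; bicategory

theorem tri_right {c : B} {U Z : a ⟶ c} {V : c ⟶ a} (φ : U ⟶ Z) (W : 𝟙 a ⟶ U ≫ V) :
    (𝟙 _ ⊗≫ Z† ◁ tcoev U ⊗≫ Z† ◁ φ ▷ U† ⊗≫ tev Z ▷ U† ⊗≫ 𝟙 _ : Z† ⟶ U†) ⊗≫
      U† ◁ W ⊗≫ tev U ▷ V ⊗≫ 𝟙 V =
    𝟙 _ ⊗≫ Z† ◁ W ⊗≫ Z† ◁ φ ▷ V ⊗≫ tev Z ▷ V ⊗≫ 𝟙 V := by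
  calc _ = 𝟙 _ ⊗≫ ((𝟙 _ ⊗≫ Z† ◁ tcoev U ⊗≫ Z† ◁ φ ▷ U† ⊗≫ tev Z ▷ U† ⊗≫ 𝟙 _ : Z† ⟶ U†)
            ▷ 𝟙 a ≫ U† ◁ W) ⊗≫ tev U ▷ V ⊗≫ 𝟙 V := by bicategory
    _ = 𝟙 _ ⊗≫ Z† ◁ W ⊗≫ Z† ◁ tcoev U ▷ (U ≫ V) ⊗≫ Z† ◁ φ ▷ (U† ≫ U ≫ V) ⊗≫
          (tev Z ▷ (U† ≫ U) ≫ 𝟙 c ◁ tev U) ▷ V ⊗≫ 𝟙 V := by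
        rw [← whisker_exchange]; bicategory
    _ = 𝟙 _ ⊗≫ Z† ◁ W ⊗≫ Z† ◁ tcoev U ▷ (U ≫ V) ⊗≫ Z† ◁ (φ ▷ (U† ≫ U) ≫
          Z ◁ tev U) ▷ V ⊗≫ tev Z ▷ V ⊗≫ 𝟙 V := by
        rw [← whisker_exchange]; bicategory
    _ = 𝟙 _ ⊗≫ Z† ◁ W ⊗≫ Z† ◁ (tcoev U ▷ U ⊗≫ U ◁ tev U) ▷ V ⊗≫ Z† ◁ φ ▷ V ⊗≫
          tev Z ▷ V ⊗≫ 𝟙 V := by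
        rw [← whisker_exchange]; bicategory
    _ = _ := by rw [z3]; bicategory

theorem tri_left {c : B} {U Z : a ⟶ c} {V : c ⟶ a} (φ : U ⟶ Z) (W : 𝟙 c ⟶ V ≫ U) :
    (𝟙 _ ⊗≫ coev U ▷ Z† ⊗≫ U† ◁ φ ▷ Z† ⊗≫ U† ◁ ev Z ⊗≫ 𝟙 _ : Z† ⟶ U†) ⊗≫
      W ▷ U† ⊗≫ V ◁ ev U ⊗≫ 𝟙 V =
    𝟙 _ ⊗≫ W ▷ Z† ⊗≫ V ◁ φ ▷ Z† ⊗≫ V ◁ ev Z ⊗≫ 𝟙 V := by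
  calc _ = 𝟙 _ ⊗≫ (𝟙 c ◁ (𝟙 _ ⊗≫ coev U ▷ Z† ⊗≫ U† ◁ φ ▷ Z† ⊗≫ U† ◁ ev Z ⊗≫ 𝟙 _ : Z† ⟶ U†)
            ≫ W ▷ U†) ⊗≫ V ◁ ev U ⊗≫ 𝟙 V := by bicategory
    _ = 𝟙 _ ⊗≫ W ▷ Z† ⊗≫ V ◁ U ◁ coev U ▷ Z† ⊗≫ V ◁ (U ≫ U†) ◁ φ ▷ Z† ⊗≫
          V ◁ ((U ≫ U†) ◁ ev Z ≫ ev U ▷ 𝟙 a) ⊗≫ 𝟙 V := by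
        rw [whisker_exchange]; bicategory
    _ = 𝟙 _ ⊗≫ W ▷ Z† ⊗≫ V ◁ U ◁ coev U ▷ Z† ⊗≫ V ◁ ((U ≫ U†) ◁ φ ≫ ev U ▷ Z) ▷ Z† ⊗≫
          V ◁ ev Z ⊗≫ 𝟙 V := by
        rw [whisker_exchange]; bicategory
    _ = 𝟙 _ ⊗≫ W ▷ Z† ⊗≫ V ◁ (U ◁ coev U ⊗≫ ev U ▷ U) ▷ Z† ⊗≫ V ◁ φ ▷ Z† ⊗≫
          V ◁ ev Z ⊗≫ 𝟙 V := by
        rw [whisker_exchange]; bicategory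
    _ = _ := by rw [z2]; bicategory

theorem pivotal_tri {Z : a ⟶ c} (φ : X ≫ Y ⟶ Z) :
    (𝟙 _ ⊗≫ Z† ◁ (tcoev X ⊗≫ X ◁ tcoev Y ▷ X† ⊗≫ 𝟙 ((X ≫ Y) ≫ (Y† ≫ X†))) ⊗≫
      Z† ◁ φ ▷ (Y† ≫ X†) ⊗≫ tev Z ▷ (Y† ≫ X†) ⊗≫ 𝟙 _ : Z† ⟶ Y† ≫ X†) =
    𝟙 _ ⊗≫ (coev Y ⊗≫ Y† ◁ coev X ▷ Y ⊗≫ 𝟙 ((Y† ≫ X†) ≫ (X ≫ Y))) ▷ Z† ⊗≫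
      (Y† ≫ X†) ◁ φ ▷ Z† ⊗≫ (Y† ≫ X†) ◁ ev Z ⊗≫ 𝟙 _ := by
  have h1 := pivotal_map φ
  have h2 := pivotal_comp X Y
  have h5 := tri_right φ (tcoev X ⊗≫ X ◁ tcoev Y ▷ X† ⊗≫ 𝟙 ((X ≫ Y) ≫ (Y† ≫ X†)))
  have h6 := tri_left φ (coev Y ⊗≫ Y† ◁ coev X ▷ Y ⊗≫ 𝟙 ((Y† ≫ X†) ≫ (X ≫ Y)))
  refine Eq.trans ?_ ((h5.symm.trans ?_).trans (h6.trans ?_))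
  · bicategory
  rotate_left
  · bicategory
  rw [h1]
  have h3 : (𝟙 ((X ≫ Y)†) ⊗≫ (X ≫ Y)† ◁ (tcoev X ⊗≫ X ◁ tcoev Y ▷ X† ⊗≫ 𝟙 ((X ≫ Y) ≫ (Y† ≫ X†))) ⊗≫
      tev (X ≫ Y) ▷ (Y† ≫ X†) ⊗≫ 𝟙 (Y† ≫ X†)) = 𝟙 ((X ≫ Y)†) ⊗≫
      (coev Y ⊗≫ Y† ◁ coev X ▷ Y ⊗≫ 𝟙 ((Y† ≫ X†) ≫ (X ≫ Y))) ▷ (X ≫ Y)† ⊗≫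
      (Y† ≫ X†) ◁ ev (X ≫ Y) ⊗≫ 𝟙 (Y† ≫ X†) := by
    refine Eq.trans ?_ (h2.trans ?_) <;> bicategory
  have h4 := congrArg (fun t => (𝟙 (Z†) ⊗≫ (leftAdj (X ≫ Y)).unit ▷ Z† ⊗≫
      (X ≫ Y)† ◁ φ ▷ Z† ⊗≫ (X ≫ Y)† ◁ (leftAdj Z).counit ⊗≫ 𝟙 (X ≫ Y)†) ⊗≫ t) h3
  refine Eq.trans ?_ (h4.trans ?_) <;> bicategory

def uR (a : B) : 𝟙 a ⟶ (𝟙 a)† := tcoev (𝟙 a) ≫ (λ_ _).hom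
def uL (a : B) : 𝟙 a ⟶ (𝟙 a)† := coev (𝟙 a) ≫ (ρ_ _).hom
def eR (a : B) : (𝟙 a)† ⟶ 𝟙 a := (ρ_ _).inv ≫ tev (𝟙 a)
def eL (a : B) : (𝟙 a)† ⟶ 𝟙 a := (λ_ _).inv ≫ ev (𝟙 a)

theorem uR_eR (a : B) : uR a ≫ eR a = 𝟙 _ := by
  have h := congrArg (fun t => (λ_ (𝟙 a)).inv ≫ t ≫ (ρ_ (𝟙 a)).hom) (z3 (𝟙 a))
  refine Eq.trans ?_ (h.trans ?_)
  · simp only [uR, eR]; bicategory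
  · bicategory
theorem uL_eL (a : B) : uL a ≫ eL a = 𝟙 _ := by
  have h := congrArg (fun t => (ρ_ (𝟙 a)).inv ≫ t ≫ (λ_ (𝟙 a)).hom) (z2 (𝟙 a))
  refine Eq.trans ?_ (h.trans ?_)
  · simp only [uL, eL]; bicategory
  · bicategory
theorem eL_uL (a : B) : eL a ≫ uL a = 𝟙 _ := by
  have h := z1 (𝟙 a)
  calc _ = (λ_ _).inv ≫ (λ_ _).inv ≫ (𝟙 a ◁ ev (𝟙 a) ≫ coev (𝟙 a) ▷ 𝟙 a) ⊗≫ 𝟙 _ := by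
        simp only [uL, eL]; bicategory
    _ = (λ_ _).inv ≫ (coev (𝟙 a) ▷ (𝟙 a)† ⊗≫ (𝟙 a)† ◁ ev (𝟙 a)) ⊗≫ 𝟙 _ := by
        rw [whisker_exchange]; bicategory
    _ = _ := by rw [h]; bicategory

theorem eR_uR (a : B) : eR a ≫ uR a = 𝟙 _ := by
  have h := z4 (𝟙 a)
  calc _ = 𝟙 _ ⊗≫ (tev (𝟙 a) ▷ 𝟙 a ≫ 𝟙 a ◁ tcoev (𝟙 a)) ⊗≫ 𝟙 ((𝟙 a)†) := by
        simp only [uR, eR]; bicategory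
    _ = 𝟙 _ ⊗≫ ((𝟙 a)† ◁ tcoev (𝟙 a) ⊗≫ tev (𝟙 a) ▷ (𝟙 a)†) ⊗≫ 𝟙 _ := by
        rw [← whisker_exchange]; bicategory
    _ = _ := by rw [h]; bicategory

theorem uu (u : 𝟙 a ⟶ (𝟙 a)†) (e : (𝟙 a)† ⟶ 𝟙 a) :
    (u ⊗≫ u ▷ (𝟙 a)†) ≫ (𝟙 a)† ◁ e ⊗≫ e = u ≫ e ≫ u ≫ e := by
  calc _ = u ⊗≫ (u ▷ (𝟙 a)† ≫ (𝟙 a)† ◁ e) ⊗≫ e := by bicategory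
    _ = _ := by rw [← whisker_exchange]; bicategory

theorem uR_eq_uL (a : B) : uR a = uL a := by
  have h := pivotal_tri (𝟙 a) (𝟙 a) (λ_ (𝟙 a)).hom
  have h1 : eR a ≫ (uR a ⊗≫ uR a ▷ (𝟙 a)†) = eL a ≫ (uL a ⊗≫ uL a ▷ (𝟙 a)†) := by
    have e1 : uR a ⊗≫ uR a ▷ (𝟙 a)† = tcoev (𝟙 a) ⊗≫ 𝟙 a ◁ tcoev (𝟙 a) ▷ (𝟙 a)† ⊗≫ 𝟙 _ := by
      simp only [uR]; bicategory
    have e2 : uL a ⊗≫ uL a ▷ (𝟙 a)† = coev (𝟙 a) ⊗≫ (𝟙 a)† ◁ coev (𝟙 a) ▷ 𝟙 a ⊗≫ 𝟙 _ := by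
      calc _ = 𝟙 _ ⊗≫ (𝟙 a ◁ uL a ≫ uL a ▷ (𝟙 a)†) := by bicategory
        _ = _ := by rw [whisker_exchange]; simp only [uL]; bicategory
    rw [e1, e2]
    refine Eq.trans ?_ (h.trans ?_)
    · symm
      calc _ = 𝟙 _ ⊗≫ ((𝟙 a)† ◁ (tcoev (𝟙 a) ⊗≫ 𝟙 a ◁ tcoev (𝟙 a) ▷ (𝟙 a)† ⊗≫
              𝟙 ((𝟙 a)† ≫ (𝟙 a)†)) ≫ eR a ▷ ((𝟙 a)† ≫ (𝟙 a)†)) ⊗≫ 𝟙 _ := by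
            simp only [eR]; bicategory
        _ = _ := by rw [whisker_exchange]; bicategory
    · calc _ = 𝟙 _ ⊗≫ ((coev (𝟙 a) ⊗≫ (𝟙 a)† ◁ coev (𝟙 a) ▷ 𝟙 a ⊗≫
              𝟙 ((𝟙 a)† ≫ (𝟙 a)†)) ▷ (𝟙 a)† ≫ ((𝟙 a)† ≫ (𝟙 a)†) ◁ eL a) ⊗≫ 𝟙 _ := by
            simp only [eL]; bicategory
        _ = _ := by rw [← whisker_exchange]; bicategory
  have h2 := congrArg (fun t => uR a ≫ t ≫ (𝟙 a)† ◁ eL a ⊗≫ eL a) h1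
  simp only [Category.assoc] at h2
  rw [reassoc_of% uR_eR] at h2
  have h3 := uu (uR a) (eL a)
  have h4 := uu (uL a) (eL a)
  have h5 : uR a ≫ eL a ≫ uR a ≫ eL a = uR a ≫ eL a := by
    rw [← h3]
    refine Eq.trans ?_ (h2.trans ?_)
    · bicategory
    · calc _ = uR a ≫ eL a ≫ ((uL a ⊗≫ uL a ▷ (𝟙 a)†) ≫ (𝟙 a)† ◁ eL a ⊗≫ eL a) := by bicategory
        _ = _ := by rw [h4, reassoc_of% uL_eL, uL_eL]; simp
  have h6 : uR a ≫ eL a = 𝟙 _ := by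
    have := congrArg (fun t => uL a ≫ eR a ≫ t) h5
    rw [reassoc_of% eR_uR, reassoc_of% uL_eL] at this
    rw [this, reassoc_of% eR_uR, uL_eL]
  have := h6 =≫ uL a
  rw [Category.assoc, eL_uL] at this
  simpa using this

theorem counit_dual {A : a ⟶ a} (f : A ⟶ 𝟙 a) :
    tcoev A ≫ f ▷ A† ≫ (λ_ _).hom = coev A ≫ A† ◁ f ≫ (ρ_ _).hom := by
  have h := congrArg (fun t => uR a ≫ t) (pivotal_map f)
  refine Eq.trans ?_ (h.trans ?_)
  · symm
    calc _ = 𝟙 _ ⊗≫ (uR a ▷ 𝟙 a ≫ (𝟙 a)† ◁ tcoev A) ⊗≫ (𝟙 a)† ◁ f ▷ A† ⊗≫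
          tev (𝟙 a) ▷ A† ⊗≫ 𝟙 _ := by bicategory
      _ = 𝟙 _ ⊗≫ tcoev A ⊗≫ (uR a ▷ A ≫ (𝟙 a)† ◁ f) ▷ A† ⊗≫
          tev (𝟙 a) ▷ A† ⊗≫ 𝟙 _ := by rw [← whisker_exchange]; bicategory
      _ = 𝟙 _ ⊗≫ tcoev A ⊗≫ f ▷ A† ⊗≫ (uR a ≫ eR a) ▷ A† ⊗≫ 𝟙 _ := by
          rw [← whisker_exchange]; simp only [eR]; bicategory
      _ = _ := by rw [uR_eR]; bicategory
  · rw [uR_eq_uL]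
    calc _ = 𝟙 _ ⊗≫ (𝟙 a ◁ uL a ≫ coev A ▷ (𝟙 a)†) ⊗≫ A† ◁ f ▷ (𝟙 a)† ⊗≫
          A† ◁ ev (𝟙 a) ⊗≫ 𝟙 _ := by bicategory
      _ = 𝟙 _ ⊗≫ coev A ⊗≫ A† ◁ (A ◁ uL a ≫ f ▷ (𝟙 a)†) ⊗≫
          A† ◁ ev (𝟙 a) ⊗≫ 𝟙 _ := by rw [whisker_exchange]; bicategory
      _ = 𝟙 _ ⊗≫ coev A ⊗≫ A† ◁ f ⊗≫ A† ◁ (uL a ≫ eL a) ⊗≫ 𝟙 _ := by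
          rw [whisker_exchange]; simp only [eL]; bicategory
      _ = _ := by rw [uL_eL]; bicategory

theorem ext_left {P : b ⟶ a} {f g : P ⟶ X†} (h : X ◁ f ≫ ev X = X ◁ g ≫ ev X) : f = g := by
  have key : ∀ f : P ⟶ X†, f = 𝟙 _ ⊗≫ coev X ▷ P ⊗≫ X† ◁ (X ◁ f ≫ ev X) ⊗≫ 𝟙 _ := by
    intro f
    symm
    calc _ = 𝟙 _ ⊗≫ (coev X ▷ P ≫ (X† ≫ X) ◁ f) ⊗≫ X† ◁ ev X ⊗≫ 𝟙 _ := by bicategory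
      _ = 𝟙 _ ⊗≫ f ⊗≫ (coev X ▷ X† ⊗≫ X† ◁ ev X) ⊗≫ 𝟙 _ := by
        rw [← whisker_exchange]; bicategory
      _ = _ := by rw [z1]; bicategory
  rw [key f, key g, h]

theorem ext_right {P : b ⟶ a} {f g : P ⟶ X†} (h : f ▷ X ≫ tev X = g ▷ X ≫ tev X) : f = g := by
  have key : ∀ f : P ⟶ X†, f = 𝟙 _ ⊗≫ P ◁ tcoev X ⊗≫ (f ▷ X ≫ tev X) ▷ X† ⊗≫ 𝟙 _ := by
    intro f
    symm
    calc _ = 𝟙 _ ⊗≫ (P ◁ tcoev X ≫ f ▷ (X ≫ X†)) ⊗≫ tev X ▷ X† ⊗≫ 𝟙 _ := by bicategory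
      _ = 𝟙 _ ⊗≫ f ⊗≫ (X† ◁ tcoev X ⊗≫ tev X ▷ X†) ⊗≫ 𝟙 _ := by
        rw [whisker_exchange]; bicategory
      _ = _ := by rw [z4]; bicategory
  rw [key f, key g, h]

variable {X} {A : a ⟶ a} {C : b ⟶ b}

/-- The left action of `A` on `X†` obtained from a right action `r` of `A` on `X`. -/
def dualLact (r : A ≫ X ⟶ X) : X† ≫ A ⟶ X† :=
  𝟙 _ ⊗≫ (X† ≫ A) ◁ tcoev X ⊗≫ X† ◁ r ▷ X† ⊗≫ tev X ▷ X† ⊗≫ 𝟙 _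

/-- The right action of `C` on `X†` obtained from a left action `l` of `C` on `X`: the strand `C`
is bent around the dualised strand `X` by means of `tcoev C` and `ev C`. -/
def dualRact (l : X ≫ C ⟶ X) : C ≫ X† ⟶ X† :=
  𝟙 _ ⊗≫ (C ≫ X†) ◁ tcoev X ⊗≫ (C ≫ X† ≫ X) ◁ tcoev C ▷ X† ⊗≫
    (C ≫ X†) ◁ l ▷ (C† ≫ X†) ⊗≫ C ◁ tev X ▷ (C† ≫ X†) ⊗≫ ev C ▷ X† ⊗≫ 𝟙 _

/-- A simpler form of `dualRact`, equal to it by pivotality. -/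
def dualRact' (l : X ≫ C ⟶ X) : C ≫ X† ⟶ X† :=
  𝟙 _ ⊗≫ coev X ▷ (C ≫ X†) ⊗≫ X† ◁ l ▷ X† ⊗≫ X† ◁ ev X ⊗≫ 𝟙 _

theorem dualRact_eq (l : X ≫ C ⟶ X) : dualRact l = dualRact' l := by
  have h := congrArg (fun t => 𝟙 (C ≫ X†) ⊗≫ C ◁ t ⊗≫ ev C ▷ X† ⊗≫ 𝟙 (X†)) (pivotal_tri X C l)
  refine Eq.trans ?_ (h.trans ?_)
  · simp only [dualRact]; bicategory
  · calc _ = 𝟙 _ ⊗≫ C ◁ coev C ▷ X† ⊗≫ (C ≫ C†) ◁ (𝟙 (C ≫ X†) ⊗≫ coev X ▷ (C ≫ X†) ⊗≫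
            X† ◁ l ▷ X† ⊗≫ X† ◁ ev X ⊗≫ 𝟙 (X†)) ⊗≫ ev C ▷ X† ⊗≫ 𝟙 (X†) := by bicategory
      _ = 𝟙 _ ⊗≫ C ◁ coev C ▷ X† ⊗≫ ((C ≫ C†) ◁ dualRact' l ≫ ev C ▷ X†) ⊗≫ 𝟙 (X†) := by
          simp only [dualRact']; bicategory
      _ = 𝟙 _ ⊗≫ (C ◁ coev C ⊗≫ ev C ▷ C) ▷ X† ⊗≫ dualRact' l ⊗≫ 𝟙 (X†) := by
          rw [whisker_exchange]; bicategory
      _ = _ := by rw [z2]; bicategory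

theorem dualLact_tev (r : A ≫ X ⟶ X) :
    dualLact r ▷ X ≫ tev X = (α_ _ _ _).hom ≫ X† ◁ r ≫ tev X := by
  calc _ = 𝟙 _ ⊗≫ (X† ≫ A) ◁ tcoev X ▷ X ⊗≫ X† ◁ r ▷ (X† ≫ X) ⊗≫
        (tev X ▷ (X† ≫ X) ≫ 𝟙 _ ◁ tev X) ⊗≫ 𝟙 _ := by simp only [dualLact]; bicategory
    _ = 𝟙 _ ⊗≫ (X† ≫ A) ◁ tcoev X ▷ X ⊗≫ X† ◁ (r ▷ (X† ≫ X) ≫ X ◁ tev X) ⊗≫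
        tev X ⊗≫ 𝟙 _ := by rw [← whisker_exchange]; bicategory
    _ = 𝟙 _ ⊗≫ (X† ≫ A) ◁ (tcoev X ▷ X ⊗≫ X ◁ tev X) ⊗≫ X† ◁ r ⊗≫
        tev X ⊗≫ 𝟙 _ := by rw [← whisker_exchange]; bicategory
    _ = _ := by rw [z3]; bicategory

theorem dualRact'_ev (l : X ≫ C ⟶ X) :
    X ◁ dualRact' l ≫ ev X = (α_ _ _ _).inv ≫ l ▷ X† ≫ ev X := by
  calc _ = 𝟙 _ ⊗≫ X ◁ coev X ▷ (C ≫ X†) ⊗≫ (X ≫ X†) ◁ l ▷ X† ⊗≫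
        ((X ≫ X†) ◁ ev X ≫ ev X ▷ 𝟙 _) ⊗≫ 𝟙 _ := by simp only [dualRact']; bicategory
    _ = 𝟙 _ ⊗≫ X ◁ coev X ▷ (C ≫ X†) ⊗≫ ((X ≫ X†) ◁ l ≫ ev X ▷ X) ▷ X† ⊗≫
        ev X ⊗≫ 𝟙 _ := by rw [whisker_exchange]; bicategory
    _ = 𝟙 _ ⊗≫ (X ◁ coev X ⊗≫ ev X ▷ X) ▷ (C ≫ X†) ⊗≫ l ▷ X† ⊗≫
        ev X ⊗≫ 𝟙 _ := by rw [whisker_exchange]; bicategory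
    _ = _ := by rw [z2]; bicategory

theorem dualRact_tev (l : X ≫ C ⟶ X) :
    dualRact l ▷ X ≫ tev X = 𝟙 _ ⊗≫ (C ≫ X† ≫ X) ◁ tcoev C ⊗≫ (C ≫ X†) ◁ l ▷ C† ⊗≫
      C ◁ tev X ▷ C† ⊗≫ ev C := by
  calc _ = 𝟙 _ ⊗≫ (C ≫ X†) ◁ tcoev X ▷ X ⊗≫ (C ≫ X† ≫ X) ◁ tcoev C ▷ (X† ≫ X) ⊗≫
        (C ≫ X†) ◁ l ▷ (C† ≫ X† ≫ X) ⊗≫ C ◁ tev X ▷ (C† ≫ X† ≫ X) ⊗≫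
        (ev C ▷ (X† ≫ X) ≫ 𝟙 _ ◁ tev X) ⊗≫ 𝟙 _ := by simp only [dualRact]; bicategory
    _ = 𝟙 _ ⊗≫ (C ≫ X†) ◁ tcoev X ▷ X ⊗≫ (C ≫ X† ≫ X) ◁ tcoev C ▷ (X† ≫ X) ⊗≫
        (C ≫ X†) ◁ l ▷ (C† ≫ X† ≫ X) ⊗≫ C ◁ (tev X ▷ (C† ≫ X† ≫ X) ≫ 𝟙 _ ◁ C† ◁ tev X) ⊗≫
        ev C ⊗≫ 𝟙 _ := by rw [← whisker_exchange]; bicategory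
    _ = 𝟙 _ ⊗≫ (C ≫ X†) ◁ tcoev X ▷ X ⊗≫ (C ≫ X† ≫ X) ◁ tcoev C ▷ (X† ≫ X) ⊗≫
        (C ≫ X†) ◁ (l ▷ (C† ≫ X† ≫ X) ≫ X ◁ C† ◁ tev X) ⊗≫ C ◁ tev X ▷ C† ⊗≫
        ev C ⊗≫ 𝟙 _ := by rw [← whisker_exchange]; bicategory
    _ = 𝟙 _ ⊗≫ (C ≫ X†) ◁ tcoev X ▷ X ⊗≫ (C ≫ X† ≫ X) ◁ (tcoev C ▷ (X† ≫ X) ≫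
        (C ≫ C†) ◁ tev X) ⊗≫
        (C ≫ X†) ◁ l ▷ C† ⊗≫ C ◁ tev X ▷ C† ⊗≫
        ev C ⊗≫ 𝟙 _ := by rw [← whisker_exchange]; bicategory
    _ = 𝟙 _ ⊗≫ (C ≫ X†) ◁ (tcoev X ▷ X ⊗≫ X ◁ tev X) ⊗≫ (C ≫ X† ≫ X) ◁ tcoev C ⊗≫
        (C ≫ X†) ◁ l ▷ C† ⊗≫ C ◁ tev X ▷ C† ⊗≫
        ev C ⊗≫ 𝟙 _ := by rw [← whisker_exchange]; bicategory
    _ = _ := by rw [z3]; bicategory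

theorem dual_comm (r : A ≫ X ⟶ X) (l : X ≫ C ⟶ X)
    (h : r ▷ C ≫ l = (α_ _ _ _).hom ≫ A ◁ l ≫ r) :
    dualRact l ▷ A ≫ dualLact r = (α_ _ _ _).hom ≫ C ◁ dualLact r ≫ dualRact l := by
  apply ext_right
  calc _ = 𝟙 _ ⊗≫ dualRact l ▷ (A ≫ X) ⊗≫ (dualLact r ▷ X ≫ tev X) := by bicategory
    _ = 𝟙 _ ⊗≫ (dualRact l ▷ (A ≫ X) ≫ X† ◁ r) ≫ tev X := by
        rw [dualLact_tev]; bicategory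
    _ = 𝟙 _ ⊗≫ (C ≫ X†) ◁ r ≫ (dualRact l ▷ X ≫ tev X) := by
        rw [← whisker_exchange]; bicategory
    _ = 𝟙 _ ⊗≫ (C ≫ X†) ◁ (r ▷ 𝟙 _ ≫ X ◁ tcoev C) ⊗≫ (C ≫ X†) ◁ l ▷ C† ⊗≫
          C ◁ tev X ▷ C† ⊗≫ ev C := by
        rw [dualRact_tev]; bicategory
    _ = 𝟙 _ ⊗≫ (C ≫ X† ≫ A ≫ X) ◁ tcoev C ⊗≫ (C ≫ X†) ◁ (r ▷ C ≫ l) ▷ C† ⊗≫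
          C ◁ tev X ▷ C† ⊗≫ ev C := by
        rw [← whisker_exchange]; bicategory
    _ = 𝟙 _ ⊗≫ (C ≫ X† ≫ A ≫ X) ◁ tcoev C ⊗≫ (C ≫ X† ≫ A) ◁ l ▷ C† ⊗≫
          C ◁ ((α_ _ _ _).hom ≫ X† ◁ r ≫ tev X) ▷ C† ⊗≫ ev C := by
        rw [h]; bicategory
    _ = 𝟙 _ ⊗≫ (C ≫ X† ≫ A ≫ X) ◁ tcoev C ⊗≫ C ◁ ((X† ≫ A) ◁ l ≫ dualLact r ▷ X) ▷ C† ⊗≫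
          C ◁ tev X ▷ C† ⊗≫ ev C := by
        rw [← dualLact_tev]; bicategory
    _ = 𝟙 _ ⊗≫ C ◁ ((X† ≫ A) ◁ X ◁ tcoev C ≫ dualLact r ▷ (X ≫ C ≫ C†)) ⊗≫
          C ◁ X† ◁ l ▷ C† ⊗≫ C ◁ tev X ▷ C† ⊗≫ ev C := by
        rw [whisker_exchange]; bicategory
    _ = 𝟙 _ ⊗≫ (C ◁ dualLact r) ▷ X ≫ (𝟙 _ ⊗≫ (C ≫ X† ≫ X) ◁ tcoev C ⊗≫
          (C ≫ X†) ◁ l ▷ C† ⊗≫ C ◁ tev X ▷ C† ⊗≫ ev C) := by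
        rw [whisker_exchange]; bicategory
    _ = _ := by rw [← dualRact_tev]; bicategory

theorem dualLact_assoc (mul : A ≫ A ⟶ A) (r : A ≫ X ⟶ X)
    (h : mul ▷ X ≫ r = (α_ _ _ _).hom ≫ A ◁ r ≫ r) :
    dualLact r ▷ A ≫ dualLact r = (α_ _ _ _).hom ≫ X† ◁ mul ≫ dualLact r := by
  apply ext_right
  calc _ = 𝟙 _ ⊗≫ dualLact r ▷ (A ≫ X) ⊗≫ (dualLact r ▷ X ≫ tev X) := by bicategory
    _ = 𝟙 _ ⊗≫ (dualLact r ▷ (A ≫ X) ≫ X† ◁ r) ≫ tev X := by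
        rw [dualLact_tev]; bicategory
    _ = 𝟙 _ ⊗≫ (X† ≫ A) ◁ r ≫ (dualLact r ▷ X ≫ tev X) := by
        rw [← whisker_exchange]; bicategory
    _ = 𝟙 _ ⊗≫ X† ◁ ((α_ _ _ _).hom ≫ A ◁ r ≫ r) ≫ tev X := by
        rw [dualLact_tev]; bicategory
    _ = 𝟙 _ ⊗≫ X† ◁ mul ▷ X ≫ (α_ _ _ _).inv ≫ ((α_ _ _ _).hom ≫ X† ◁ r ≫ tev X) := by
        rw [← h]; bicategory
    _ = _ := by rw [← dualLact_tev]; bicategory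

theorem dualLact_one (one : 𝟙 a ⟶ A) (r : A ≫ X ⟶ X) (h : one ▷ X ≫ r = (λ_ _).hom) :
    X† ◁ one ≫ dualLact r = (ρ_ _).hom := by
  apply ext_right
  calc _ = 𝟙 _ ⊗≫ X† ◁ one ▷ X ≫ (α_ _ _ _).inv ≫ (dualLact r ▷ X ≫ tev X) := by bicategory
    _ = 𝟙 _ ⊗≫ X† ◁ (one ▷ X ≫ r) ≫ tev X := by rw [dualLact_tev]; bicategory
    _ = _ := by rw [h]; bicategory

theorem dualRact_assoc (mul : C ≫ C ⟶ C) (l : X ≫ C ⟶ X)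
    (h : l ▷ C ≫ l = (α_ _ _ _).hom ≫ X ◁ mul ≫ l) :
    mul ▷ X† ≫ dualRact l = (α_ _ _ _).hom ≫ C ◁ dualRact l ≫ dualRact l := by
  rw [dualRact_eq]
  apply ext_left
  symm
  calc _ = 𝟙 _ ⊗≫ (X ≫ C) ◁ dualRact' l ≫ (α_ _ _ _).hom ≫
        (X ◁ dualRact' l ≫ ev X) := by bicategory
    _ = 𝟙 _ ⊗≫ ((X ≫ C) ◁ dualRact' l ≫ l ▷ X†) ≫ ev X := by
        rw [dualRact'_ev]; bicategory
    _ = 𝟙 _ ⊗≫ l ▷ (C ≫ X†) ≫ (X ◁ dualRact' l ≫ ev X) := by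
        rw [whisker_exchange]; bicategory
    _ = 𝟙 _ ⊗≫ (l ▷ C ≫ l) ▷ X† ≫ ev X := by
        rw [dualRact'_ev]; bicategory
    _ = 𝟙 _ ⊗≫ X ◁ mul ▷ X† ≫ ((α_ _ _ _).inv ≫ l ▷ X† ≫ ev X) := by
        rw [h]; bicategory
    _ = _ := by rw [← dualRact'_ev]; bicategory

theorem dualRact_one (one : 𝟙 b ⟶ C) (l : X ≫ C ⟶ X) (h : X ◁ one ≫ l = (ρ_ _).hom) :
    one ▷ X† ≫ dualRact l = (λ_ _).hom := by
  rw [dualRact_eq]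
  apply ext_left
  calc _ = 𝟙 _ ⊗≫ X ◁ one ▷ X† ≫ (X ◁ dualRact' l ≫ ev X) := by bicategory
    _ = 𝟙 _ ⊗≫ (X ◁ one ≫ l) ▷ X† ≫ ev X := by rw [dualRact'_ev]; bicategory
    _ = _ := by rw [h]; bicategory
end

section Nakayama
variable {a : B} {M : a ⟶ a} {p : M ≫ M ⟶ 𝟙 a} {c : 𝟙 a ⟶ M ≫ M}

def phiR (p : M ≫ M ⟶ 𝟙 a) : M ⟶ M† :=
  𝟙 _ ⊗≫ M ◁ tcoev M ⊗≫ p ▷ M† ⊗≫ 𝟙 _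

def psiR (c : 𝟙 a ⟶ M ≫ M) : M† ⟶ M :=
  𝟙 _ ⊗≫ c ▷ M† ⊗≫ M ◁ ev M ⊗≫ 𝟙 _

def phiL (p : M ≫ M ⟶ 𝟙 a) : M ⟶ M† :=
  𝟙 _ ⊗≫ coev M ▷ M ⊗≫ M† ◁ p ⊗≫ 𝟙 _

def psiL (c : 𝟙 a ⟶ M ≫ M) : M† ⟶ M :=
  𝟙 _ ⊗≫ M† ◁ c ⊗≫ tev M ▷ M ⊗≫ 𝟙 _

theorem phiR_psiL (h2 : M ◁ c ⊗≫ p ▷ M = 𝟙 _ ⊗≫ 𝟙 _) : phiR p ≫ psiL c = 𝟙 M := by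
  calc _ = 𝟙 _ ⊗≫ M ◁ tcoev M ⊗≫ (p ▷ (M† ≫ 𝟙 a) ≫ 𝟙 _ ◁ M† ◁ c) ⊗≫ tev M ▷ M ⊗≫ 𝟙 M := by
        simp only [phiR, psiL]; bicategory
    _ = 𝟙 _ ⊗≫ M ◁ tcoev M ⊗≫ (M ≫ M ≫ M†) ◁ c ⊗≫
          (p ▷ (M† ≫ M) ≫ 𝟙 _ ◁ tev M) ▷ M ⊗≫ 𝟙 M := by
        rw [← whisker_exchange]; bicategory
    _ = 𝟙 _ ⊗≫ M ◁ (tcoev M ▷ 𝟙 a ≫ (M ≫ M†) ◁ c) ⊗≫ (M ≫ M) ◁ tev M ▷ M ⊗≫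
          p ▷ M ⊗≫ 𝟙 M := by
        rw [← whisker_exchange]; bicategory
    _ = 𝟙 _ ⊗≫ M ◁ c ⊗≫ M ◁ (tcoev M ▷ M ⊗≫ M ◁ tev M) ▷ M ⊗≫
          p ▷ M ⊗≫ 𝟙 M := by
        rw [← whisker_exchange]; bicategory
    _ = 𝟙 _ ⊗≫ (M ◁ c ⊗≫ p ▷ M) ⊗≫ 𝟙 M := by
        rw [z3]; bicategory
    _ = _ := by rw [h2]; bicategory

theorem psiL_phiR (h1 : c ▷ M ⊗≫ M ◁ p = 𝟙 _ ⊗≫ 𝟙 _) : psiL c ≫ phiR p = 𝟙 (M†) := by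
  calc _ = 𝟙 _ ⊗≫ M† ◁ c ⊗≫ (tev M ▷ (M ≫ 𝟙 a) ≫ 𝟙 _ ◁ M ◁ tcoev M) ⊗≫ p ▷ M† ⊗≫
          𝟙 (M†) := by
        simp only [phiR, psiL]; bicategory
    _ = 𝟙 _ ⊗≫ M† ◁ (c ▷ 𝟙 a ≫ (M ≫ M) ◁ tcoev M) ⊗≫ (tev M ▷ (M ≫ M) ≫
          𝟙 _ ◁ p) ▷ M† ⊗≫ 𝟙 (M†) := by
        rw [← whisker_exchange]; bicategory
    _ = 𝟙 _ ⊗≫ M† ◁ tcoev M ⊗≫ M† ◁ (c ▷ M ⊗≫ M ◁ p) ▷ M† ⊗≫ tev M ▷ M† ⊗≫ 𝟙 (M†) := by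
        rw [← whisker_exchange, ← whisker_exchange]; bicategory
    _ = 𝟙 _ ⊗≫ (M† ◁ tcoev M ⊗≫ tev M ▷ M†) ⊗≫ 𝟙 (M†) := by
        rw [h1]; bicategory
    _ = _ := by rw [z4]; bicategory

theorem phiL_psiR (h1 : c ▷ M ⊗≫ M ◁ p = 𝟙 _ ⊗≫ 𝟙 _) : phiL p ≫ psiR c = 𝟙 M := by
  calc _ = 𝟙 _ ⊗≫ coev M ▷ M ⊗≫ (𝟙 _ ◁ M† ◁ p ≫ c ▷ (M† ≫ 𝟙 a)) ⊗≫ M ◁ ev M ⊗≫ 𝟙 M := by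
        simp only [phiL, psiR]; bicategory
    _ = 𝟙 _ ⊗≫ (𝟙 _ ◁ coev M ≫ c ▷ (M† ≫ M)) ▷ M ⊗≫
          M ◁ ((M ≫ M†) ◁ p ≫ ev M ▷ 𝟙 a) ⊗≫ 𝟙 M := by
        rw [whisker_exchange]; bicategory
    _ = 𝟙 _ ⊗≫ c ▷ M ⊗≫ M ◁ (M ◁ coev M ⊗≫ ev M ▷ M) ▷ M ⊗≫ M ◁ p ⊗≫ 𝟙 M := by
        rw [whisker_exchange, whisker_exchange]; bicategory
    _ = 𝟙 _ ⊗≫ (c ▷ M ⊗≫ M ◁ p) ⊗≫ 𝟙 M := by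
        rw [z2]; bicategory
    _ = _ := by rw [h1]; bicategory

theorem psiR_phiL (h2 : M ◁ c ⊗≫ p ▷ M = 𝟙 _ ⊗≫ 𝟙 _) : psiR c ≫ phiL p = 𝟙 (M†) := by
  calc _ = 𝟙 _ ⊗≫ c ▷ M† ⊗≫ (𝟙 _ ◁ M ◁ ev M ≫ coev M ▷ (M ≫ 𝟙 a)) ⊗≫ M† ◁ p ⊗≫
          𝟙 (M†) := by
        simp only [phiL, psiR]; bicategory
    _ = 𝟙 _ ⊗≫ (𝟙 _ ◁ c ≫ coev M ▷ (M ≫ M)) ▷ M† ⊗≫ M† ◁ ((M ≫ M) ◁ ev M ≫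
          p ▷ 𝟙 a) ⊗≫ 𝟙 (M†) := by
        rw [whisker_exchange]; bicategory
    _ = 𝟙 _ ⊗≫ coev M ▷ M† ⊗≫ M† ◁ (M ◁ c ⊗≫ p ▷ M) ▷ M† ⊗≫ M† ◁ ev M ⊗≫ 𝟙 (M†) := by
        rw [whisker_exchange, whisker_exchange]; bicategory
    _ = 𝟙 _ ⊗≫ (coev M ▷ M† ⊗≫ M† ◁ ev M) ⊗≫ 𝟙 (M†) := by
        rw [h2]; bicategory
    _ = _ := by rw [z1]; bicategory

variable {m : M ≫ M ⟶ M} {e : M ⟶ 𝟙 a} {u : 𝟙 a ⟶ M}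

theorem one_phi (hu : u ▷ M ≫ m = (λ_ M).hom) (hu' : M ◁ u ≫ m = (ρ_ M).hom) :
    u ≫ phiR (m ≫ e) = u ≫ phiL (m ≫ e) := by
  have h := counit_dual e
  calc _ = 𝟙 _ ⊗≫ (u ▷ 𝟙 a ≫ M ◁ tcoev M) ⊗≫ m ▷ M† ⊗≫ e ▷ M† ⊗≫ 𝟙 _ := by
        simp only [phiR]; bicategory
    _ = 𝟙 _ ⊗≫ tcoev M ⊗≫ (u ▷ M ≫ m) ▷ M† ⊗≫ e ▷ M† ⊗≫ 𝟙 _ := by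
        rw [← whisker_exchange]; bicategory
    _ = tcoev M ≫ e ▷ M† ≫ (λ_ _).hom := by rw [hu]; bicategory
    _ = 𝟙 _ ⊗≫ coev M ⊗≫ M† ◁ (M ◁ u ≫ m) ⊗≫ M† ◁ e ⊗≫ 𝟙 _ := by
        rw [h, hu']; bicategory
    _ = 𝟙 _ ⊗≫ (𝟙 _ ◁ u ≫ coev M ▷ M) ⊗≫ M† ◁ m ⊗≫ M† ◁ e ⊗≫ 𝟙 _ := by
        rw [whisker_exchange]; bicategory
    _ = _ := by simp only [phiL]; bicategory

theorem mul_phiR (hm : m ▷ M ≫ m = (α_ _ _ _).hom ≫ M ◁ m ≫ m) :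
    m ≫ phiR (m ≫ e) = phiR (m ≫ e) ▷ M ≫ dualLact m := by
  apply ext_right
  have key : phiR (m ≫ e) ▷ M ≫ tev M = m ≫ e := by
    calc _ = 𝟙 _ ⊗≫ M ◁ tcoev M ▷ M ⊗≫ ((m ≫ e) ▷ (M† ≫ M) ≫ 𝟙 _ ◁ tev M) ⊗≫ 𝟙 _ := by
          simp only [phiR]; bicategory
      _ = 𝟙 _ ⊗≫ M ◁ (tcoev M ▷ M ⊗≫ M ◁ tev M) ⊗≫ (m ≫ e) ⊗≫ 𝟙 _ := by
          rw [← whisker_exchange]; bicategory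
      _ = _ := by rw [z3]; bicategory
  calc _ = m ▷ M ≫ (phiR (m ≫ e) ▷ M ≫ tev M) := by simp
    _ = (α_ _ _ _).hom ≫ M ◁ m ≫ (phiR (m ≫ e) ▷ M ≫ tev M) := by
        rw [key, reassoc_of% hm]
    _ = (α_ _ _ _).hom ≫ phiR (m ≫ e) ▷ (M ≫ M) ≫ M† ◁ m ≫ tev M := by
        rw [whisker_exchange_assoc]
    _ = 𝟙 _ ⊗≫ phiR (m ≫ e) ▷ M ▷ M ⊗≫ ((α_ _ _ _).hom ≫ M† ◁ m ≫ tev M) := by bicategory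
    _ = _ := by rw [← dualLact_tev]; bicategory

theorem mul_phiL (hm : m ▷ M ≫ m = (α_ _ _ _).hom ≫ M ◁ m ≫ m) :
    m ≫ phiL (m ≫ e) = M ◁ phiL (m ≫ e) ≫ dualRact m := by
  rw [dualRact_eq]
  apply ext_left
  have key : M ◁ phiL (m ≫ e) ≫ ev M = m ≫ e := by
    calc _ = 𝟙 _ ⊗≫ M ◁ coev M ▷ M ⊗≫ ((M ≫ M†) ◁ (m ≫ e) ≫ ev M ▷ 𝟙 a) ⊗≫ 𝟙 _ := by
          simp only [phiL]; bicategory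
      _ = 𝟙 _ ⊗≫ (M ◁ coev M ⊗≫ ev M ▷ M) ▷ M ⊗≫ (m ≫ e) ⊗≫ 𝟙 _ := by
          rw [whisker_exchange]; bicategory
      _ = _ := by rw [z2]; bicategory
  calc _ = M ◁ m ≫ (M ◁ phiL (m ≫ e) ≫ ev M) := by simp
    _ = (α_ _ _ _).inv ≫ m ▷ M ≫ (M ◁ phiL (m ≫ e) ≫ ev M) := by
        rw [key, reassoc_of% hm]; simp
    _ = (α_ _ _ _).inv ≫ (M ≫ M) ◁ phiL (m ≫ e) ≫ m ▷ M† ≫ ev M := by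
        rw [whisker_exchange_assoc]
    _ = 𝟙 _ ⊗≫ M ◁ M ◁ phiL (m ≫ e) ⊗≫ ((α_ _ _ _).inv ≫ m ▷ M† ≫ ev M) := by bicategory
    _ = _ := by rw [← dualRact'_ev]; bicategory

theorem one_gamma (hu : u ▷ M ≫ m = (λ_ M).hom) (hu' : M ◁ u ≫ m = (ρ_ M).hom)
    (h1 : c ▷ M ⊗≫ M ◁ (m ≫ e) = 𝟙 _ ⊗≫ 𝟙 _) :
    u ≫ phiR (m ≫ e) ≫ psiR c = u := by
  rw [← Category.assoc, one_phi hu hu', Category.assoc, phiL_psiR h1, Category.comp_id]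

theorem mul_gamma (hm : m ▷ M ≫ m = (α_ _ _ _).hom ≫ M ◁ m ≫ m)
    (hu : u ▷ M ≫ m = (λ_ M).hom) (hu' : M ◁ u ≫ m = (ρ_ M).hom)
    (h1 : c ▷ M ⊗≫ M ◁ (m ≫ e) = 𝟙 _ ⊗≫ 𝟙 _) (h2 : M ◁ c ⊗≫ (m ≫ e) ▷ M = 𝟙 _ ⊗≫ 𝟙 _) :
    m ≫ phiR (m ≫ e) ≫ psiR c =
      (phiR (m ≫ e) ≫ psiR c) ▷ M ≫ M ◁ (phiR (m ≫ e) ≫ psiR c) ≫ m := by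
  set γ := phiR (m ≫ e) ≫ psiR c with hγ
  have hφ : γ ≫ phiL (m ≫ e) = phiR (m ≫ e) := by
    rw [hγ, Category.assoc, psiR_phiL h2, Category.comp_id]
  have e1 : (λ_ M).inv ≫ (u ≫ phiR (m ≫ e)) ▷ M ≫ dualLact m = phiR (m ≫ e) := by
    rw [comp_whiskerRight, Category.assoc, ← mul_phiR hm, reassoc_of% hu]; simp
  have e2 : (ρ_ M).inv ≫ M ◁ (u ≫ phiR (m ≫ e)) ≫ dualRact m = phiL (m ≫ e) := by
    rw [one_phi hu hu', whiskerLeft_comp, Category.assoc, ← mul_phiL hm, reassoc_of% hu']; simp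
  set w := u ≫ phiR (m ≫ e)
  have key : m ≫ phiR (m ≫ e) = M ◁ phiR (m ≫ e) ≫ γ ▷ M† ≫ dualRact m := by
    calc _ = phiR (m ≫ e) ▷ M ≫ dualLact m := mul_phiR hm
      _ = γ ▷ M ≫ phiL (m ≫ e) ▷ M ≫ dualLact m := by
          rw [← comp_whiskerRight_assoc, hφ]
      _ = γ ▷ M ≫ (ρ_ M).inv ▷ M ≫ (M ◁ w) ▷ M ≫ (dualRact m ▷ M ≫ dualLact m) := by
          rw [← e2]; simp
      _ = γ ▷ M ≫ M ◁ ((λ_ M).inv ≫ w ▷ M ≫ dualLact m) ≫ dualRact m := by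
          rw [dual_comm m m hm]; bicategory
      _ = _ := by rw [e1, whisker_exchange_assoc]
  have key2 : (γ ▷ M ≫ M ◁ γ ≫ m) ≫ phiL (m ≫ e) = m ≫ phiR (m ≫ e) := by
    rw [key, Category.assoc, Category.assoc, mul_phiL hm, ← whiskerLeft_comp_assoc, hφ,
      whisker_exchange_assoc]
  calc m ≫ γ = (m ≫ phiR (m ≫ e)) ≫ psiR c := by rw [hγ, Category.assoc]
    _ = _ := by rw [← key2, Category.assoc, phiL_psiR h1, Category.comp_id]


variable (A : FrobeniusAlgebra a)

/-- The Nakayama automorphism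
`γ_A = (ev_A ⊗ 1) ∘ (1 ⊗ (Δ ∘ η)) ∘ (1 ⊗ (ε ∘ μ)) ∘ (tcoev_A ⊗ 1)` as a 2-morphism `A ⟶ A`. -/
def nakayamaHom : A.obj ⟶ A.obj :=
  𝟙 _ ⊗≫ A.obj ◁ tcoev A.obj ⊗≫ A.pairing ▷ A.obj† ⊗≫ A.copairing ▷ A.obj† ⊗≫
    A.obj ◁ ev A.obj ⊗≫ 𝟙 _

/-- The inverse Nakayama automorphism
`γ_A⁻¹ = (1 ⊗ tev_A) ∘ ((Δ ∘ η) ⊗ 1) ∘ ((ε ∘ μ) ⊗ 1) ∘ (1 ⊗ coev_A)`. -/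
def nakayamaInv : A.obj ⟶ A.obj :=
  𝟙 _ ⊗≫ coev A.obj ▷ A.obj ⊗≫ A.obj† ◁ A.pairing ⊗≫ A.obj† ◁ A.copairing ⊗≫
    tev A.obj ▷ A.obj ⊗≫ 𝟙 _

theorem nakayamaHom_eq : nakayamaHom A = phiR A.pairing ≫ psiR A.copairing := by
  simp only [nakayamaHom, phiR, psiR]; bicategory

theorem nakayamaInv_eq : nakayamaInv A = phiL A.pairing ≫ psiL A.copairing := by
  simp only [nakayamaInv, phiL, psiL]; bicategory

theorem nakayama_hom_inv : nakayamaHom A ≫ nakayamaInv A = 𝟙 _ := by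
  rw [nakayamaHom_eq, nakayamaInv_eq, Category.assoc, reassoc_of% psiR_phiL A.snake2,
    phiR_psiL A.snake2]

theorem nakayama_inv_hom : nakayamaInv A ≫ nakayamaHom A = 𝟙 _ := by
  rw [nakayamaHom_eq, nakayamaInv_eq, Category.assoc, reassoc_of% psiL_phiR A.snake1,
    phiL_psiR A.snake1]
end Nakayama
end Pivotal

/-- Algebra automorphisms of (the algebra underlying) a Frobenius algebra. -/
structure AlgAut {a : B} (A : FrobeniusAlgebra a) where
  iso : A.obj ≅ A.obj
  one_hom : A.one ≫ iso.hom = A.one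
  mul_hom : A.mul ≫ iso.hom = iso.hom ▷ A.obj ≫ A.obj ◁ iso.hom ≫ A.mul

namespace AlgAut
variable {a : B} {A : FrobeniusAlgebra a}

/-- The identity automorphism. -/
def refl (A : FrobeniusAlgebra a) : AlgAut A where
  iso := Iso.refl _
  one_hom := by simp
  mul_hom := by simp

/-- The inverse automorphism. -/
def symm (α : AlgAut A) : AlgAut A where
  iso := α.iso.symm
  one_hom := by
    rw [Iso.symm_hom, Iso.comp_inv_eq, α.one_hom]
  mul_hom := by
    rw [Iso.symm_hom, Iso.comp_inv_eq]
    simp only [Category.assoc, α.mul_hom]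
    rw [whisker_exchange_assoc, ← comp_whiskerRight_assoc, Iso.inv_hom_id, id_whiskerRight,
      Category.id_comp, ← whiskerLeft_comp_assoc, Iso.inv_hom_id, whiskerLeft_id,
      Category.id_comp]
end AlgAut

/-- The twisted bimodule `_β X _α`: the left and right actions of `X` precomposed with the
algebra automorphisms `β` and `α`. -/
def twist {a b : Beq B} (β : AlgAut b.alg.toFrobeniusAlgebra) (X : Bimodule a b)
    (α : AlgAut a.alg.toFrobeniusAlgebra) : Bimodule a b where
  obj := X.obj
  lact := X.obj ◁ β.iso.hom ≫ X.lact
  ract := α.iso.hom ▷ X.obj ≫ X.ract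
  lact_assoc := by
    have h := X.lact_assoc
    calc _ = 𝟙 _ ⊗≫ X.obj ◁ β.iso.hom ▷ b.alg.obj ⊗≫ (X.lact ▷ b.alg.obj ≫ X.obj ◁ β.iso.hom) ≫
          X.lact := by bicategory
      _ = 𝟙 _ ⊗≫ X.obj ◁ (β.iso.hom ▷ b.alg.obj ≫ b.alg.obj ◁ β.iso.hom) ⊗≫
          (X.lact ▷ b.alg.obj ≫ X.lact) := by rw [← whisker_exchange X.lact β.iso.hom]; bicategory
      _ = 𝟙 _ ⊗≫ X.obj ◁ (β.iso.hom ▷ b.alg.obj ≫ b.alg.obj ◁ β.iso.hom ≫ b.alg.mul) ≫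
          X.lact := by rw [h]; bicategory
      _ = _ := by rw [← β.mul_hom]; bicategory
  lact_one := by
    rw [← whiskerLeft_comp_assoc, β.one_hom, X.lact_one]
  ract_assoc := by
    have h := X.ract_assoc
    symm
    calc _ = 𝟙 _ ⊗≫ a.alg.obj ◁ α.iso.hom ▷ X.obj ⊗≫ (a.alg.obj ◁ X.ract ≫
          α.iso.hom ▷ X.obj) ≫ X.ract := by bicategory
      _ = 𝟙 _ ⊗≫ (a.alg.obj ◁ α.iso.hom ≫ α.iso.hom ▷ a.alg.obj) ▷ X.obj ⊗≫
          ((α_ _ _ _).hom ≫ a.alg.obj ◁ X.ract ≫ X.ract) := by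
        rw [whisker_exchange]; bicategory
      _ = 𝟙 _ ⊗≫ (α.iso.hom ▷ a.alg.obj ≫ a.alg.obj ◁ α.iso.hom ≫ a.alg.mul) ▷ X.obj ≫
          X.ract := by rw [← h, whisker_exchange]; bicategory
      _ = _ := by rw [← α.mul_hom]; bicategory
  ract_one := by
    rw [← comp_whiskerRight_assoc, α.one_hom, X.ract_one]
  act_comm := by
    have h := X.act_comm
    calc _ = α.iso.hom ▷ X.obj ▷ b.alg.obj ⊗≫ (X.ract ▷ b.alg.obj ≫ X.obj ◁ β.iso.hom) ≫
          X.lact := by bicategory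
      _ = 𝟙 _ ⊗≫ (α.iso.hom ▷ (X.obj ≫ b.alg.obj) ≫ a.alg.obj ◁ X.obj ◁ β.iso.hom) ⊗≫
          (X.ract ▷ b.alg.obj ≫ X.lact) := by rw [← whisker_exchange]; bicategory
      _ = 𝟙 _ ⊗≫ a.alg.obj ◁ X.obj ◁ β.iso.hom ⊗≫ (α.iso.hom ▷ (X.obj ≫ b.alg.obj) ≫
          a.alg.obj ◁ X.lact) ≫ X.ract := by rw [h, ← whisker_exchange]; bicategory
      _ = _ := by rw [← whisker_exchange]; bicategory

section Adjoints
open PivotalBicategory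
variable [PivotalBicategory B]

/-- The Nakayama automorphism as an algebra automorphism. -/
def nakayama {a : B} (A : FrobeniusAlgebra a) : AlgAut A where
  iso := ⟨nakayamaHom A, nakayamaInv A, nakayama_hom_inv A, nakayama_inv_hom A⟩
  one_hom := by
    change A.one ≫ nakayamaHom A = A.one
    rw [nakayamaHom_eq]
    exact one_gamma A.one_mul A.mul_one A.snake1
  mul_hom := by
    change A.mul ≫ nakayamaHom A = nakayamaHom A ▷ A.obj ≫ A.obj ◁ nakayamaHom A ≫ A.mul
    rw [nakayamaHom_eq]
    exact mul_gamma A.mul_assoc A.one_mul A.mul_one A.snake1 A.snake2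

variable {a b : Beq B} (X : Bimodule a b)

/-- The `A`-`B`-bimodule `X†` of a `B`-`A`-bimodule `X`. -/
def dagger : Bimodule b a where
  obj := X.obj†
  lact := dualLact X.ract
  ract := dualRact X.lact
  lact_assoc := dualLact_assoc _ _ X.ract_assoc
  lact_one := dualLact_one _ _ X.ract_one
  ract_assoc := dualRact_assoc _ _ X.lact_assoc
  ract_one := dualRact_one _ _ X.lact_one
  act_comm := dual_comm _ _ X.act_comm

/-- `⋆X`: the bimodule `X†` with left action twisted by the inverse Nakayama automorphism
of `A`. -/
def leftDual : Bimodule b a :=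
  twist (nakayama a.alg.toFrobeniusAlgebra).symm (dagger X) (AlgAut.refl _)

/-- `X⋆`: the bimodule `X†` with right action twisted by the Nakayama automorphism of `B`. -/
def rightDual : Bimodule b a :=
  twist (AlgAut.refl _) (dagger X) (nakayama b.alg.toFrobeniusAlgebra)

/-- `X† ⊗ X → A`: insert `Δ ∘ η` of `A` to the right of `X`, let its left leg act on `X` from the
right, evaluate with `ev_X`, and output the right leg. -/
def leftEvAux : X.obj ≫ X.obj† ⟶ a.alg.obj :=
  𝟙 _ ⊗≫ a.alg.copairing ▷ (X.obj ≫ X.obj†) ⊗≫ a.alg.obj ◁ X.ract ▷ X.obj† ⊗≫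
    a.alg.obj ◁ ev X.obj ⊗≫ 𝟙 _

/-- `B → X ⊗ X†`: create `X ⊗ X†` with `coev_X` and let `B` act on `X` from the left. -/
def leftCoevAux : b.alg.obj ⟶ X.obj† ≫ X.obj :=
  𝟙 _ ⊗≫ coev X.obj ▷ b.alg.obj ⊗≫ X.obj† ◁ X.lact ⊗≫ 𝟙 _

/-- `X ⊗ X† → B`: insert `Δ ∘ η` of `B` to the left of `X`, let its right leg act on `X` from the
left, evaluate with `tev_X`, and output the left leg. -/
def rightEvAux : X.obj† ≫ X.obj ⟶ b.alg.obj :=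
  𝟙 _ ⊗≫ (X.obj† ≫ X.obj) ◁ b.alg.copairing ⊗≫ X.obj† ◁ X.lact ▷ b.alg.obj ⊗≫
    tev X.obj ▷ b.alg.obj ⊗≫ 𝟙 _

/-- `A → X† ⊗ X`: create `X† ⊗ X` with `tcoev_X` and let `A` act on `X` from the right. -/
def rightCoevAux : a.alg.obj ⟶ X.obj ≫ X.obj† :=
  𝟙 _ ⊗≫ a.alg.obj ◁ tcoev X.obj ⊗≫ X.ract ▷ X.obj† ⊗≫ 𝟙 _

variable [∀ x y : B, IsIdempotentComplete (x ⟶ y)]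

/-- The evaluation `⋆X ⊗_B X → A` (as a 2-morphism of `B`) of the adjunction `⋆X ⊣ X`. -/
noncomputable def leftEv : (tensor X (leftDual X)).obj ⟶ a.alg.obj :=
  ξ X (leftDual X) ≫ leftEvAux X

/-- The coevaluation `B → X ⊗_A ⋆X` of the adjunction `⋆X ⊣ X`. -/
noncomputable def leftCoev : b.alg.obj ⟶ (tensor (leftDual X) X).obj :=
  leftCoevAux X ≫ ϑ (leftDual X) X

/-- The evaluation `X ⊗_A X⋆ → B` of the adjunction `X ⊣ X⋆`. -/
noncomputable def rightEv : (tensor (rightDual X) X).obj ⟶ b.alg.obj :=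
  ξ (rightDual X) X ≫ rightEvAux X

/-- The coevaluation `A → X⋆ ⊗_B X` of the adjunction `X ⊣ X⋆`. -/
noncomputable def rightCoev : a.alg.obj ⟶ (tensor X (rightDual X)).obj :=
  rightCoevAux X ≫ ϑ X (rightDual X)

end Adjoints
end EquivariantCompletion

/-!
The 2-morphisms `leftEvAux X` and `rightEvAux X` are determined by the Frobenius pairing
`ε ∘ μ`: pairing `leftEvAux X` with an element of `A` on the left gives `ev_X ∘ ρ`
(`leftEvAux_pairing`), and pairing `rightEvAux X` with an element of `B` on the right gives
`tev_X ∘ λ` (`rightEvAux_pairing`). As the pairing is nondegenerate, each identity between maps into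
`A` or `B` may be checked after pairing, where it becomes a statement about `ev_X` or `tev_X`.

The action of `A` on `X†` is dual to `ρ` with respect to `tev_X`. With respect to `ev_X`, pivotality
expresses it by bending the strand `A` around `X` (`dualLact_ev`), and this bending differs from the
Frobenius pairing by the Nakayama automorphism (`phiL_nakayamaInv_tev`, which rests on the
invariance of the pairing under that automorphism). Hence the action twisted by the inverse
automorphism satisfies `leftDualLact_ev`: under `ev_X` it is multiplication on the values of
`leftEvAux X`. From this follow the linearity of the evaluation and the reduction of the zigzag on
`⋆X` to the zigzag on `X`. The latter holds because `X† ⊣ X` in `B` and because, by separability, the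
two legs of the copairing acting in succession are the identity. The right dual is the mirror image.

The passage to relative tensor products is formal: the projections `ϑ` are split epimorphisms, so
balanced and linear 2-morphisms on the unreduced composites which satisfy zigzags there give
adjunctions in the equivariant completion (`exists_adjunction`).
-/

namespace EquivariantCompletion
variable {B : Type u} [Bicategory.{w, v} B]

theorem leftZigzag_eq {C : Type u} [Bicategory.{w, v} C] {x y : C} {f : x ⟶ y} {g : y ⟶ x}
    (η : 𝟙 x ⟶ f ≫ g) (e : g ≫ f ⟶ 𝟙 y) :
    leftZigzag η e = η ▷ f ≫ (α_ f g f).hom ≫ f ◁ e := by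
  rw [leftZigzag]; bicategory

theorem rightZigzag_eq {C : Type u} [Bicategory.{w, v} C] {x y : C} {f : x ⟶ y} {g : y ⟶ x}
    (η : 𝟙 x ⟶ f ≫ g) (e : g ≫ f ⟶ 𝟙 y) :
    rightZigzag η e = g ◁ η ≫ (α_ g f g).inv ≫ e ▷ g := by
  rw [rightZigzag]; bicategory

/-! ### Adjunctions in the equivariant completion -/

section Adjunction
variable [∀ x y : B, IsIdempotentComplete (x ⟶ y)] {a b : Beq B}

/-- The bimodule map `L ⊗_B X → A` (written `tensor X L ⟶ unit a`) induced by a `B`-balanced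
2-morphism `E : L ⊗ X → A` that is left and right `A`-linear. -/
noncomputable def counitOfBalanced {X : Bimodule a b} {L : Bimodule b a}
    (E : X.obj ≫ L.obj ⟶ a.alg.obj)
    (hbal : X.lact ▷ L.obj ≫ E = (α_ _ _ _).hom ≫ X.obj ◁ L.ract ≫ E)
    (hl : (α_ _ _ _).hom ≫ X.obj ◁ L.lact ≫ E = E ▷ a.alg.obj ≫ a.alg.mul)
    (hr : (α_ _ _ _).inv ≫ X.ract ▷ L.obj ≫ E = a.alg.obj ◁ E ≫ a.alg.mul) :
    tensor X L ⟶ unit a where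
  hom := ξ X L ≫ E
  lact_hom := by
    change (tensor X L).lact ≫ (ξ X L ≫ E : (tensor X L).obj ⟶ a.alg.obj) =
      (ξ X L ≫ E : (tensor X L).obj ⟶ a.alg.obj) ▷ a.alg.obj ≫ a.alg.mul
    rw [← cancel_epi (ϑ X L ▷ a.alg.obj), reassoc_of% ϑ_lact, ϑ_desc X L E hbal, hl,
      ← comp_whiskerRight_assoc, ϑ_desc X L E hbal]
  ract_hom := by
    change (tensor X L).ract ≫ (ξ X L ≫ E : (tensor X L).obj ⟶ a.alg.obj) =
      a.alg.obj ◁ (ξ X L ≫ E : (tensor X L).obj ⟶ a.alg.obj) ≫ a.alg.mul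
    rw [← cancel_epi (a.alg.obj ◁ ϑ X L), reassoc_of% ϑ_ract, ϑ_desc X L E hbal, hr,
      ← whiskerLeft_comp_assoc, ϑ_desc X L E hbal]

/-- The bimodule map `B → X ⊗_A L` (written `unit b ⟶ tensor L X`) induced by a left and right
`B`-linear 2-morphism `C : B → X ⊗ L`. -/
noncomputable def unitOfLinear {X : Bimodule a b} {L : Bimodule b a}
    (C : b.alg.obj ⟶ L.obj ≫ X.obj)
    (hl : b.alg.mul ≫ C = C ▷ b.alg.obj ≫ (α_ _ _ _).hom ≫ L.obj ◁ X.lact)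
    (hr : b.alg.mul ≫ C = b.alg.obj ◁ C ≫ (α_ _ _ _).inv ≫ L.ract ▷ X.obj) :
    unit b ⟶ tensor L X where
  hom := C ≫ ϑ L X
  lact_hom := by
    change b.alg.mul ≫ C ≫ ϑ L X =
      (C ≫ ϑ L X : b.alg.obj ⟶ (tensor L X).obj) ▷ b.alg.obj ≫ (tensor L X).lact
    rw [reassoc_of% hl, comp_whiskerRight, Category.assoc, ϑ_lact]
  ract_hom := by
    change b.alg.mul ≫ C ≫ ϑ L X =
      b.alg.obj ◁ (C ≫ ϑ L X : b.alg.obj ⟶ (tensor L X).obj) ≫ (tensor L X).ract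
    rw [reassoc_of% hr, whiskerLeft_comp, Category.assoc, ϑ_ract]

/-- A balanced bilinear evaluation `E` and a bilinear coevaluation `C` present an adjunction
`L ⊣ X` in the equivariant completion as soon as the zigzag composites, formed in `B` with the
unreduced tensor products and closed off by an action, equal the actions `zL` and `zX`. -/
theorem exists_adjunction {X : Bimodule a b} {L : Bimodule b a}
    {E : X.obj ≫ L.obj ⟶ a.alg.obj} {C : b.alg.obj ⟶ L.obj ≫ X.obj}
    (hE : X.lact ▷ L.obj ≫ E = (α_ _ _ _).hom ≫ X.obj ◁ L.ract ≫ E)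
    (hEl : (α_ _ _ _).hom ≫ X.obj ◁ L.lact ≫ E = E ▷ a.alg.obj ≫ a.alg.mul)
    (hEr : (α_ _ _ _).inv ≫ X.ract ▷ L.obj ≫ E = a.alg.obj ◁ E ≫ a.alg.mul)
    (hCl : b.alg.mul ≫ C = C ▷ b.alg.obj ≫ (α_ _ _ _).hom ≫ L.obj ◁ X.lact)
    (hCr : b.alg.mul ≫ C = b.alg.obj ◁ C ≫ (α_ _ _ _).inv ≫ L.ract ▷ X.obj)
    (zL : C ▷ L.obj ≫ (α_ _ _ _).hom ≫ L.obj ◁ E ≫ L.lact = L.ract)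
    (zX : X.obj ◁ C ≫ (α_ _ _ _).inv ≫ E ▷ X.obj ≫ X.ract = X.lact) :
    ∃ adj : Bicategory.Adjunction (a := b) (b := a) L X,
      BimoduleHom.hom adj.counit = ξ X L ≫ E ∧ BimoduleHom.hom adj.unit = C ≫ ϑ L X := by
  have hη : ϑr L ≫ mapRightHom (unitOfLinear C hCl hCr) L =
      (C ≫ ϑ L X) ▷ L.obj ≫ ϑ (tensor L X) L := ϑ_mapRight (unitOfLinear C hCl hCr) L
  have hε : ϑ L (tensor X L) ≫ mapLeftHom L (counitOfBalanced E hE hEl hEr) =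
      L.obj ◁ (ξ X L ≫ E) ≫ ϑl L := ϑ_mapLeft L (counitOfBalanced E hE hEl hEr)
  have hη' : ϑl X ≫ mapLeftHom X (unitOfLinear C hCl hCr) =
      X.obj ◁ (C ≫ ϑ L X) ≫ ϑ X (tensor L X) := ϑ_mapLeft X (unitOfLinear C hCl hCr)
  have hε' : ϑ (tensor X L) X ≫ mapRightHom (counitOfBalanced E hE hEl hEr) X =
      (ξ X L ≫ E) ▷ X.obj ≫ ϑr X := ϑ_mapRight (counitOfBalanced E hE hEl hEr) X
  refine ⟨⟨unitOfLinear C hCl hCr, counitOfBalanced E hE hEl hEr, ?_, ?_⟩, rfl, rfl⟩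
  · refine (leftZigzag_eq _ _).trans (hom_ext' _ _ ?_)
    -- In both triangles the projections `ϑ` are split epimorphisms, so it suffices to compare after
    -- precomposing with them; there the chosen splittings cancel.
    have : mapRightHom (unitOfLinear C hCl hCr) L ≫ assocHom L X L ≫
        mapLeftHom L (counitOfBalanced E hE hEl hEr) = unitRactHom L ≫ unitLactInv L := by
      rw [← cancel_epi (ϑr L), reassoc_of% ϑ_unitRactHom, reassoc_of% hη,
        comp_whiskerRight, Category.assoc, reassoc_of% (ϑ_assocHom L X L), hε,
        ← whiskerLeft_comp_assoc, ϑ_desc X L E hE, ← zL]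
      simp only [Category.assoc]
      rw [← ϑ_unitLactHom L, Category.assoc, unitLact_hom_inv, Category.comp_id]
    exact this
  · refine (rightZigzag_eq _ _).trans (hom_ext' _ _ ?_)
    have : mapLeftHom X (unitOfLinear C hCl hCr) ≫ assocInv X L X ≫
        mapRightHom (counitOfBalanced E hE hEl hEr) X = unitLactHom X ≫ unitRactInv X := by
      rw [← cancel_epi (ϑl X), reassoc_of% ϑ_unitLactHom, reassoc_of% hη',
        whiskerLeft_comp, Category.assoc, reassoc_of% (ϑ_assocInv X L X), hε',
        ← comp_whiskerRight_assoc, ϑ_desc X L E hE, ← zX]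
      simp only [Category.assoc]
      rw [← ϑ_unitRactHom X, Category.assoc, unitRact_hom_inv, Category.comp_id]
    exact this
end Adjunction

/-! ### Nondegeneracy of the Frobenius pairing -/

namespace FrobeniusAlgebra
variable {a : B} (A : FrobeniusAlgebra a)

theorem pairing_ext_left {P : a ⟶ a} {f g : P ⟶ A.obj}
    (h : A.obj ◁ f ≫ A.pairing = A.obj ◁ g ≫ A.pairing) : f = g := by
  have key : ∀ f : P ⟶ A.obj, f =
      𝟙 _ ⊗≫ A.copairing ▷ P ⊗≫ A.obj ◁ (A.obj ◁ f ≫ A.pairing) ⊗≫ 𝟙 _ := by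
    intro f
    symm
    calc _ = 𝟙 _ ⊗≫ (A.copairing ▷ P ≫ (A.obj ≫ A.obj) ◁ f) ⊗≫ A.obj ◁ A.pairing ⊗≫
          𝟙 _ := by bicategory
      _ = 𝟙 _ ⊗≫ f ⊗≫ (A.copairing ▷ A.obj ⊗≫ A.obj ◁ A.pairing) ⊗≫ 𝟙 _ := by
        rw [← whisker_exchange]; bicategory
      _ = _ := by rw [A.snake1]; bicategory
  rw [key f, key g, h]

theorem pairing_ext_right {P : a ⟶ a} {f g : P ⟶ A.obj}
    (h : f ▷ A.obj ≫ A.pairing = g ▷ A.obj ≫ A.pairing) : f = g := by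
  have key : ∀ f : P ⟶ A.obj, f =
      𝟙 _ ⊗≫ P ◁ A.copairing ⊗≫ (f ▷ A.obj ≫ A.pairing) ▷ A.obj ⊗≫ 𝟙 _ := by
    intro f
    symm
    calc _ = 𝟙 _ ⊗≫ (P ◁ A.copairing ≫ f ▷ (A.obj ≫ A.obj)) ⊗≫ A.pairing ▷ A.obj ⊗≫
          𝟙 _ := by bicategory
      _ = 𝟙 _ ⊗≫ f ⊗≫ (A.obj ◁ A.copairing ⊗≫ A.pairing ▷ A.obj) ⊗≫ 𝟙 _ := by
        rw [whisker_exchange]; bicategory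
      _ = _ := by rw [A.snake2]; bicategory
  rw [key f, key g, h]

theorem mul_pairing :
    A.mul ▷ A.obj ≫ A.pairing = (α_ _ _ _).hom ≫ A.obj ◁ A.mul ≫ A.pairing := by
  rw [pairing, reassoc_of% A.mul_assoc]

theorem one_pairing : A.one ▷ A.obj ≫ A.pairing = (λ_ _).hom ≫ A.counit := by
  rw [pairing, reassoc_of% A.one_mul]

theorem pairing_one : A.obj ◁ A.one ≫ A.pairing = (ρ_ _).hom ≫ A.counit := by
  rw [pairing, reassoc_of% A.mul_one]

end FrobeniusAlgebra

namespace Bimodule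
variable {a b : Beq B} (X : Bimodule a b)

theorem copairing_ract :
    a.alg.copairing ▷ X.obj ≫ (α_ _ _ _).hom ≫ a.alg.obj ◁ X.ract ≫ X.ract = (λ_ _).hom := by
  rw [← X.ract_assoc, ← comp_whiskerRight_assoc, a.alg.copairing_mul, X.ract_one]

theorem copairing_lact :
    X.obj ◁ b.alg.copairing ≫ (α_ _ _ _).inv ≫ X.lact ▷ b.alg.obj ≫ X.lact = (ρ_ _).hom := by
  rw [X.lact_assoc, Iso.inv_hom_id_assoc, ← whiskerLeft_comp_assoc, b.alg.copairing_mul,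
    X.lact_one]

end Bimodule

/-! ### Duals in a pivotal bicategory -/

open PivotalBicategory
variable [PivotalBicategory B]

section
variable {a b : B} (X : a ⟶ b)

/-- The map `P ⟶ X†` corresponding to `g` under the adjunction `X† ⊣ X`. -/
def curryLeft {P : b ⟶ a} (g : X ≫ P ⟶ 𝟙 a) : P ⟶ X† :=
  𝟙 _ ⊗≫ coev X ▷ P ⊗≫ X† ◁ g ⊗≫ 𝟙 _

/-- The map `P ⟶ X†` corresponding to `g` under the adjunction `X ⊣ X†`. -/
def curryRight {P : b ⟶ a} (g : P ≫ X ⟶ 𝟙 b) : P ⟶ X† :=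
  𝟙 _ ⊗≫ P ◁ tcoev X ⊗≫ g ▷ X† ⊗≫ 𝟙 _

theorem curryLeft_ev {P : b ⟶ a} (g : X ≫ P ⟶ 𝟙 a) : X ◁ curryLeft X g ≫ ev X = g := by
  rw [curryLeft]
  calc _ = 𝟙 _ ⊗≫ X ◁ coev X ▷ P ⊗≫ ((X ≫ X†) ◁ g ≫ ev X ▷ 𝟙 _) ⊗≫ 𝟙 _ := by bicategory
    _ = 𝟙 _ ⊗≫ (X ◁ coev X ⊗≫ ev X ▷ X) ▷ P ⊗≫ g ⊗≫ 𝟙 _ := by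
      rw [whisker_exchange]; bicategory
    _ = _ := by rw [z2]; bicategory

theorem curryRight_tev {P : b ⟶ a} (g : P ≫ X ⟶ 𝟙 b) : curryRight X g ▷ X ≫ tev X = g := by
  rw [curryRight]
  calc _ = 𝟙 _ ⊗≫ P ◁ tcoev X ▷ X ⊗≫ (g ▷ (X† ≫ X) ≫ 𝟙 _ ◁ tev X) ⊗≫ 𝟙 _ := by bicategory
    _ = 𝟙 _ ⊗≫ P ◁ (tcoev X ▷ X ⊗≫ X ◁ tev X) ⊗≫ g ⊗≫ 𝟙 _ := by
      rw [← whisker_exchange]; bicategory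
    _ = _ := by rw [z3]; bicategory

theorem phiL_ev {M : a ⟶ a} (p : M ≫ M ⟶ 𝟙 a) : M ◁ phiL p ≫ ev M = p := curryLeft_ev M p

theorem phiR_tev {M : a ⟶ a} (p : M ≫ M ⟶ 𝟙 a) : phiR p ▷ M ≫ tev M = p := curryRight_tev M p

/-- The two ways of evaluating a functional on the unit agree: this is pivotality for the
2-morphism `u`, together with `uR = uL` for the dual of the identity 1-morphism. -/
theorem unit_dual {A : a ⟶ a} (u : 𝟙 a ⟶ A) :
    (λ_ _).inv ≫ u ▷ A† ≫ ev A = (ρ_ _).inv ≫ A† ◁ u ≫ tev A := by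
  have h := congrArg (fun t => t ≫ eL a) (pivotal_map u)
  refine Eq.symm (Eq.trans ?_ (h.trans ?_))
  · symm
    calc _ = 𝟙 _ ⊗≫ A† ◁ (𝟙 a ◁ uR a ≫ u ▷ (𝟙 a)†) ⊗≫ tev A ▷ (𝟙 a)† ⊗≫ eL a ⊗≫ 𝟙 _ := by
          simp only [uR]; bicategory
      _ = 𝟙 _ ⊗≫ A† ◁ u ⊗≫ ((A† ≫ A) ◁ uR a ≫ tev A ▷ (𝟙 a)†) ⊗≫ eL a ⊗≫ 𝟙 _ := by
          rw [whisker_exchange]; bicategory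
      _ = 𝟙 _ ⊗≫ A† ◁ u ⊗≫ tev A ⊗≫ (uL a ≫ eL a) ⊗≫ 𝟙 _ := by
          rw [whisker_exchange, uR_eq_uL]; bicategory
      _ = _ := by rw [uL_eL]; bicategory
  · calc _ = 𝟙 _ ⊗≫ (uL a ▷ 𝟙 a ≫ (𝟙 a)† ◁ u) ▷ A† ⊗≫ (𝟙 a)† ◁ ev A ⊗≫ eL a ⊗≫ 𝟙 _ := by
          simp only [uL]; bicategory
      _ = 𝟙 _ ⊗≫ u ▷ A† ⊗≫ (uL a ▷ (A ≫ A†) ≫ (𝟙 a)† ◁ ev A) ⊗≫ eL a ⊗≫ 𝟙 _ := by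
          rw [← whisker_exchange]; bicategory
      _ = 𝟙 _ ⊗≫ u ▷ A† ⊗≫ ev A ⊗≫ (uL a ≫ eL a) ⊗≫ 𝟙 _ := by
          rw [← whisker_exchange]; bicategory
      _ = _ := by rw [uL_eL]; bicategory

variable {X} {A : a ⟶ a} {C : b ⟶ b}

/-- The matrix coefficient map `X† ⊗ X → A†` of a right action `r` of `A` on `X`: the functional
`ev_X ∘ r` on `A`, moved across by the adjunction `A† ⊣ A`. -/
def evAct (r : A ≫ X ⟶ X) : X ≫ X† ⟶ A† :=
  curryLeft A ((α_ _ _ _).inv ≫ r ▷ X† ≫ ev X)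

/-- The matrix coefficient map `X ⊗ X† → C†` of a left action `l` of `C` on `X`: the functional
`tev_X ∘ l` on `C`, moved across by the adjunction `C ⊣ C†`. -/
def tevAct (l : X ≫ C ⟶ X) : X† ≫ X ⟶ C† :=
  curryRight C ((α_ _ _ _).hom ≫ X† ◁ l ≫ tev X)

theorem evAct_ev (r : A ≫ X ⟶ X) :
    A ◁ evAct r ≫ ev A = (α_ _ _ _).inv ≫ r ▷ X† ≫ ev X := curryLeft_ev A _

theorem tevAct_tev (l : X ≫ C ⟶ X) :
    tevAct l ▷ C ≫ tev C = (α_ _ _ _).hom ≫ X† ◁ l ≫ tev X := curryRight_tev C _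

/-- The left action on `X†` is dual to `r` with respect to `tev_X` by definition; with respect to
`ev_X` the strand `A` has to be bent around `X`. Both descriptions agree by pivotality. -/
theorem dualLact_ev (r : A ≫ X ⟶ X) :
    X ◁ dualLact r ≫ ev X = (α_ _ _ _).inv ≫ evAct r ▷ A ≫ tev A := by
  have h := congrArg (fun t => 𝟙 (X† ≫ A) ⊗≫ t ▷ A ⊗≫ X† ◁ tev A ⊗≫ 𝟙 (X†)) (pivotal_tri A X r)
  have h' : dualLact r = curryLeft X ((α_ _ _ _).inv ≫ evAct r ▷ A ≫ tev A) := by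
    refine Eq.trans ?_ (h.trans ?_)
    · symm
      calc _ = 𝟙 _ ⊗≫ X† ◁ tcoev A ▷ A ⊗≫ (dualLact r ▷ (A† ≫ A) ≫ X† ◁ tev A) ⊗≫ 𝟙 (X†) := by
            simp only [dualLact]; bicategory
        _ = 𝟙 _ ⊗≫ X† ◁ (tcoev A ▷ A ⊗≫ A ◁ tev A) ⊗≫ dualLact r ⊗≫ 𝟙 (X†) := by
            rw [← whisker_exchange]; bicategory
        _ = _ := by rw [z3]; bicategory
    · simp only [evAct, curryLeft]; bicategory
  rw [h', curryLeft_ev]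

theorem dualRact_tev' (l : X ≫ C ⟶ X) :
    dualRact l ▷ X ≫ tev X = (α_ _ _ _).hom ≫ C ◁ tevAct l ≫ ev C := by
  rw [dualRact_tev, tevAct, curryRight]; bicategory

theorem dualRact_ev (l : X ≫ C ⟶ X) :
    X ◁ dualRact l ≫ ev X = (α_ _ _ _).inv ≫ l ▷ X† ≫ ev X := by
  rw [dualRact_eq, dualRact'_ev]

theorem coev_dualRact (l : X ≫ C ⟶ X) :
    C ◁ coev X ≫ (α_ _ _ _).inv ≫ dualRact l ▷ X = 𝟙 _ ⊗≫ coev X ▷ C ⊗≫ X† ◁ l := by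
  rw [dualRact_eq]
  calc _ = 𝟙 _ ⊗≫ (𝟙 _ ◁ C ◁ coev X ≫ coev X ▷ (C ≫ X† ≫ X)) ⊗≫ X† ◁ l ▷ (X† ≫ X) ⊗≫
        X† ◁ ev X ▷ X ⊗≫ 𝟙 _ := by simp only [dualRact']; bicategory
    _ = 𝟙 _ ⊗≫ coev X ▷ C ⊗≫ X† ◁ ((X ≫ C) ◁ coev X ≫ l ▷ (X† ≫ X)) ⊗≫
        X† ◁ ev X ▷ X ⊗≫ 𝟙 _ := by rw [whisker_exchange]; bicategory
    _ = 𝟙 _ ⊗≫ coev X ▷ C ⊗≫ X† ◁ l ⊗≫ X† ◁ (X ◁ coev X ⊗≫ ev X ▷ X) ⊗≫ 𝟙 _ := by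
        rw [whisker_exchange]; bicategory
    _ = _ := by rw [z2]; bicategory

theorem tcoev_dualLact (r : A ≫ X ⟶ X) :
    tcoev X ▷ A ≫ (α_ _ _ _).hom ≫ X ◁ dualLact r = 𝟙 _ ⊗≫ A ◁ tcoev X ⊗≫ r ▷ X† := by
  calc _ = 𝟙 _ ⊗≫ (tcoev X ▷ A ▷ 𝟙 _ ≫ ((X ≫ X†) ≫ A) ◁ tcoev X) ⊗≫ (X ≫ X†) ◁ r ▷ X† ⊗≫
        X ◁ tev X ▷ X† ⊗≫ 𝟙 _ := by simp only [dualLact]; bicategory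
    _ = 𝟙 _ ⊗≫ A ◁ tcoev X ⊗≫ (tcoev X ▷ (A ≫ X) ≫ (X ≫ X†) ◁ r) ▷ X† ⊗≫
        X ◁ tev X ▷ X† ⊗≫ 𝟙 _ := by rw [← whisker_exchange]; bicategory
    _ = 𝟙 _ ⊗≫ A ◁ tcoev X ⊗≫ r ▷ X† ⊗≫ (tcoev X ▷ X ⊗≫ X ◁ tev X) ▷ X† ⊗≫ 𝟙 _ := by
        rw [← whisker_exchange]; bicategory
    _ = _ := by rw [z3]; bicategory
end

/-! ### The Nakayama automorphism and the Frobenius pairing -/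

section
variable {a : B} (A : FrobeniusAlgebra a)

theorem nakayamaHom_phiL : nakayamaHom A ≫ phiL A.pairing = phiR A.pairing := by
  rw [nakayamaHom_eq, Category.assoc, psiR_phiL A.snake2, Category.comp_id]

theorem nakayamaInv_phiR : nakayamaInv A ≫ phiR A.pairing = phiL A.pairing := by
  rw [nakayamaInv_eq, Category.assoc, psiL_phiR A.snake1, Category.comp_id]

theorem nakayamaHom_counit : nakayamaHom A ≫ A.counit = A.counit := by
  have hL : (λ_ _).inv ≫ A.one ▷ A.obj ≫ A.pairing = A.counit := by simp [A.one_pairing]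
  have hR : (ρ_ _).inv ≫ A.obj ◁ A.one ≫ A.pairing = A.counit := by simp [A.pairing_one]
  calc _ = nakayamaHom A ≫ (λ_ _).inv ≫ A.one ▷ A.obj ≫ A.obj ◁ phiL A.pairing ≫ ev A.obj := by
        rw [phiL_ev, hL]
    _ = (nakayamaHom A ≫ phiL A.pairing) ≫ (λ_ _).inv ≫ A.one ▷ A.obj† ≫ ev A.obj := by
        rw [← whisker_exchange_assoc, leftUnitor_inv_naturality_assoc, Category.assoc]
        simp
    _ = phiR A.pairing ≫ (ρ_ _).inv ≫ A.obj† ◁ A.one ≫ tev A.obj := by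
        rw [nakayamaHom_phiL, unit_dual]
    _ = (ρ_ _).inv ≫ A.obj ◁ A.one ≫ phiR A.pairing ▷ A.obj ≫ tev A.obj := by
        rw [whisker_exchange_assoc]; simp
    _ = _ := by rw [phiR_tev, hR]

/-- The Nakayama automorphism preserves the Frobenius pairing, since it is multiplicative and
preserves the counit. -/
theorem nakayamaHom_pairing :
    nakayamaHom A ▷ A.obj ≫ A.obj ◁ nakayamaHom A ≫ A.pairing = A.pairing := by
  have h : A.mul ≫ nakayamaHom A = nakayamaHom A ▷ A.obj ≫ A.obj ◁ nakayamaHom A ≫ A.mul :=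
    (nakayama A).mul_hom
  rw [FrobeniusAlgebra.pairing, ← reassoc_of% h, nakayamaHom_counit]

theorem nakayamaInv_pairing :
    nakayamaInv A ▷ A.obj ≫ A.obj ◁ nakayamaInv A ≫ A.pairing = A.pairing := by
  conv_lhs => rw [← nakayamaHom_pairing A]
  rw [whisker_exchange_assoc, ← comp_whiskerRight_assoc, nakayama_inv_hom, id_whiskerRight,
    Category.id_comp, ← whiskerLeft_comp_assoc, nakayama_inv_hom]
  simp

/-- `tev_A` turns the pairing, read as a map `A → A†` through `coev_A`, back into the pairing once
the second argument is corrected by the inverse Nakayama automorphism. -/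
theorem phiL_nakayamaInv_tev :
    phiL A.pairing ▷ A.obj ≫ A.obj† ◁ nakayamaInv A ≫ tev A.obj = A.pairing := by
  rw [← nakayamaInv_phiR, comp_whiskerRight, Category.assoc, ← whisker_exchange_assoc, phiR_tev,
    nakayamaInv_pairing]

/-- Mirror image of `phiL_nakayamaInv_tev`. -/
theorem phiR_nakayamaHom_ev :
    A.obj ◁ phiR A.pairing ≫ nakayamaHom A ▷ A.obj† ≫ ev A.obj = A.pairing := by
  rw [← nakayamaHom_phiL, whiskerLeft_comp, Category.assoc, whisker_exchange_assoc, phiL_ev,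
    whisker_exchange_assoc, nakayamaHom_pairing]

end

/-! ### The evaluations of the two duals -/

section
variable {a b : Beq B} (X : Bimodule a b)

/-- `leftEvAux X` is the 2-morphism representing the functional `ev_X ∘ ρ` through the
nondegenerate pairing of `A`; this characterises it. -/
theorem leftEvAux_pairing :
    a.alg.obj ◁ leftEvAux X ≫ a.alg.pairing = (α_ _ _ _).inv ≫ X.ract ▷ X.obj† ≫ ev X.obj := by
  have h := a.alg.snake2
  calc _ = 𝟙 _ ⊗≫ a.alg.obj ◁ a.alg.copairing ▷ (X.obj ≫ X.obj†) ⊗≫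
        ((a.alg.obj ≫ a.alg.obj) ◁ (𝟙 _ ⊗≫ X.ract ▷ X.obj† ⊗≫ ev X.obj ⊗≫ 𝟙 _ :
          a.alg.obj ≫ X.obj ≫ X.obj† ⟶ 𝟙 _) ≫
        a.alg.pairing ▷ 𝟙 _) ⊗≫ 𝟙 _ := by simp only [leftEvAux]; bicategory
    _ = 𝟙 _ ⊗≫ (a.alg.obj ◁ a.alg.copairing ⊗≫ a.alg.pairing ▷ a.alg.obj) ▷ (X.obj ≫ X.obj†) ⊗≫
        X.ract ▷ X.obj† ⊗≫ ev X.obj ⊗≫ 𝟙 _ := by rw [whisker_exchange]; bicategory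
    _ = _ := by rw [h]; bicategory

/-- `rightEvAux X` is the 2-morphism representing the functional `tev_X ∘ λ` through the
nondegenerate pairing of `B`; this characterises it. -/
theorem rightEvAux_pairing :
    rightEvAux X ▷ b.alg.obj ≫ b.alg.pairing = (α_ _ _ _).hom ≫ X.obj† ◁ X.lact ≫ tev X.obj := by
  have h := b.alg.snake1
  calc _ = 𝟙 _ ⊗≫ (X.obj† ≫ X.obj) ◁ b.alg.copairing ▷ b.alg.obj ⊗≫
        ((𝟙 _ ⊗≫ X.obj† ◁ X.lact ⊗≫ tev X.obj ⊗≫ 𝟙 _ :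
          (X.obj† ≫ X.obj) ≫ b.alg.obj ⟶ 𝟙 _) ▷ (b.alg.obj ≫ b.alg.obj) ≫
        𝟙 _ ◁ b.alg.pairing) ⊗≫ 𝟙 _ := by simp only [rightEvAux]; bicategory
    _ = 𝟙 _ ⊗≫ (X.obj† ≫ X.obj) ◁ (b.alg.copairing ▷ b.alg.obj ⊗≫ b.alg.obj ◁ b.alg.pairing) ⊗≫
        X.obj† ◁ X.lact ⊗≫ tev X.obj ⊗≫ 𝟙 _ := by rw [← whisker_exchange]; bicategory
    _ = _ := by rw [h]; bicategory

theorem evAct_ract : evAct X.ract = leftEvAux X ≫ phiL a.alg.pairing := by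
  apply ext_left
  rw [evAct_ev, whiskerLeft_comp, Category.assoc, phiL_ev, leftEvAux_pairing]

theorem tevAct_lact : tevAct X.lact = rightEvAux X ≫ phiR b.alg.pairing := by
  apply ext_right
  rw [tevAct_tev, comp_whiskerRight, Category.assoc, phiR_tev, rightEvAux_pairing]

/-- The left action of `⋆X`: the left action of `X†` precomposed with the inverse Nakayama
automorphism. -/
def leftDualLact : X.obj† ≫ a.alg.obj ⟶ X.obj† :=
  X.obj† ◁ nakayamaInv a.alg.toFrobeniusAlgebra ≫ dualLact X.ract

/-- The right action of `X⋆`: the right action of `X†` precomposed with the Nakayama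
automorphism. -/
def rightDualRact : b.alg.obj ≫ X.obj† ⟶ X.obj† :=
  nakayamaHom b.alg.toFrobeniusAlgebra ▷ X.obj† ≫ dualRact X.lact

/-- The twist by the inverse Nakayama automorphism is exactly what makes the left action of `⋆X`
correspond, under `ev_X`, to multiplication on the values of `leftEvAux X`. -/
theorem leftDualLact_ev : X.obj ◁ leftDualLact X ≫ ev X.obj =
    (α_ _ _ _).inv ≫ leftEvAux X ▷ a.alg.obj ≫ a.alg.pairing := by
  rw [leftDualLact, whiskerLeft_comp, Category.assoc, dualLact_ev, evAct_ract]
  conv_rhs => rw [← phiL_nakayamaInv_tev]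
  simp only [comp_whiskerRight, Category.assoc]
  rw [associator_inv_naturality_right_assoc, whisker_exchange_assoc, whisker_exchange_assoc]

/-- The twist by the Nakayama automorphism is exactly what makes the right action of `X⋆`
correspond, under `tev_X`, to multiplication on the values of `rightEvAux X`. -/
theorem rightDualRact_tev : rightDualRact X ▷ X.obj ≫ tev X.obj =
    (α_ _ _ _).hom ≫ b.alg.obj ◁ rightEvAux X ≫ b.alg.pairing := by
  rw [rightDualRact, comp_whiskerRight, Category.assoc, dualRact_tev', tevAct_lact]
  conv_rhs => rw [← phiR_nakayamaHom_ev]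
  simp only [whiskerLeft_comp, Category.assoc]
  rw [associator_naturality_left_assoc, ← whisker_exchange_assoc, ← whisker_exchange_assoc]

/-! ### The left dual -/

theorem leftEvAux_ract : (α_ _ _ _).inv ≫ X.ract ▷ X.obj† ≫ leftEvAux X =
    a.alg.obj ◁ leftEvAux X ≫ a.alg.mul := by
  have h := leftEvAux_pairing X
  have hr := X.ract_assoc
  have hp := a.alg.mul_pairing
  refine a.alg.pairing_ext_left ?_
  calc _ = 𝟙 _ ⊗≫ a.alg.obj ◁ X.ract ▷ X.obj† ⊗≫ (a.alg.obj ◁ leftEvAux X ≫ a.alg.pairing) := by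
        bicategory
    _ = 𝟙 _ ⊗≫ ((α_ _ _ _).hom ≫ a.alg.obj ◁ X.ract ≫ X.ract) ▷ X.obj† ≫ ev X.obj := by
        rw [h]; bicategory
    _ = 𝟙 _ ⊗≫ a.alg.mul ▷ (X.obj ≫ X.obj†) ⊗≫
        ((α_ _ _ _).inv ≫ X.ract ▷ X.obj† ≫ ev X.obj) := by rw [← hr]; bicategory
    _ = 𝟙 _ ⊗≫ (a.alg.mul ▷ (X.obj ≫ X.obj†) ≫ a.alg.obj ◁ leftEvAux X) ≫ a.alg.pairing := by
        rw [← h]; bicategory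
    _ = 𝟙 _ ⊗≫ (a.alg.obj ≫ a.alg.obj) ◁ leftEvAux X ≫ (a.alg.mul ▷ a.alg.obj ≫ a.alg.pairing) := by
        rw [← whisker_exchange]; bicategory
    _ = _ := by rw [hp]; bicategory

theorem leftEvAux_lact : (α_ _ _ _).hom ≫ X.obj ◁ leftDualLact X ≫ leftEvAux X =
    leftEvAux X ▷ a.alg.obj ≫ a.alg.mul := by
  have h := leftEvAux_pairing X
  have hl := leftDualLact_ev X
  have hr := leftEvAux_ract X
  have hp := a.alg.mul_pairing
  refine a.alg.pairing_ext_left ?_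
  calc _ = 𝟙 _ ⊗≫ a.alg.obj ◁ X.obj ◁ leftDualLact X ⊗≫
        (a.alg.obj ◁ leftEvAux X ≫ a.alg.pairing) := by bicategory
    _ = 𝟙 _ ⊗≫ ((a.alg.obj ≫ X.obj) ◁ leftDualLact X ≫ X.ract ▷ X.obj†) ≫ ev X.obj := by
        rw [h]; bicategory
    _ = 𝟙 _ ⊗≫ X.ract ▷ (X.obj† ≫ a.alg.obj) ⊗≫ (X.obj ◁ leftDualLact X ≫ ev X.obj) := by
        rw [whisker_exchange]; bicategory
    _ = 𝟙 _ ⊗≫ ((α_ _ _ _).inv ≫ X.ract ▷ X.obj† ≫ leftEvAux X) ▷ a.alg.obj ⊗≫ a.alg.pairing := by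
        rw [hl]; bicategory
    _ = 𝟙 _ ⊗≫ (a.alg.obj ◁ leftEvAux X) ▷ a.alg.obj ⊗≫
        (a.alg.mul ▷ a.alg.obj ≫ a.alg.pairing) := by
        rw [hr]; bicategory
    _ = _ := by rw [hp]; bicategory

theorem leftEvAux_balanced : X.lact ▷ X.obj† ≫ leftEvAux X =
    (α_ _ _ _).hom ≫ X.obj ◁ dualRact X.lact ≫ leftEvAux X := by
  have h := leftEvAux_pairing X
  have hl := dualRact_ev X.lact
  have hc := X.act_comm
  refine a.alg.pairing_ext_left ?_
  calc _ = 𝟙 _ ⊗≫ a.alg.obj ◁ X.lact ▷ X.obj† ⊗≫ (a.alg.obj ◁ leftEvAux X ≫ a.alg.pairing) := by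
        bicategory
    _ = 𝟙 _ ⊗≫ ((α_ _ _ _).hom ≫ a.alg.obj ◁ X.lact ≫ X.ract) ▷ X.obj† ≫ ev X.obj := by
        rw [h]; bicategory
    _ = 𝟙 _ ⊗≫ X.ract ▷ (b.alg.obj ≫ X.obj†) ⊗≫
        ((α_ _ _ _).inv ≫ X.lact ▷ X.obj† ≫ ev X.obj) := by
        rw [← hc]; bicategory
    _ = 𝟙 _ ⊗≫ (X.ract ▷ (b.alg.obj ≫ X.obj†) ≫ X.obj ◁ dualRact X.lact) ⊗≫ ev X.obj := by
        rw [← hl]; bicategory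
    _ = 𝟙 _ ⊗≫ (a.alg.obj ≫ X.obj) ◁ dualRact X.lact ⊗≫
        ((α_ _ _ _).inv ≫ X.ract ▷ X.obj† ≫ ev X.obj) := by
        rw [← whisker_exchange]; bicategory
    _ = _ := by rw [← h]; bicategory

theorem leftCoevAux_lact : b.alg.mul ≫ leftCoevAux X =
    leftCoevAux X ▷ b.alg.obj ≫ (α_ _ _ _).hom ≫ X.obj† ◁ X.lact := by
  have h := X.lact_assoc
  calc _ = 𝟙 _ ⊗≫ (𝟙 _ ◁ b.alg.mul ≫ coev X.obj ▷ b.alg.obj) ⊗≫ X.obj† ◁ X.lact ⊗≫ 𝟙 _ := by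
        simp only [leftCoevAux]; bicategory
    _ = 𝟙 _ ⊗≫ coev X.obj ▷ (b.alg.obj ≫ b.alg.obj) ⊗≫
          X.obj† ◁ ((α_ _ _ _).hom ≫ X.obj ◁ b.alg.mul ≫ X.lact) ⊗≫ 𝟙 _ := by
        rw [whisker_exchange]; bicategory
    _ = _ := by rw [← h, leftCoevAux]; bicategory

theorem leftCoevAux_eq : leftCoevAux X =
    (ρ_ _).inv ≫ b.alg.obj ◁ coev X.obj ≫ (α_ _ _ _).inv ≫ dualRact X.lact ▷ X.obj := by
  rw [coev_dualRact, leftCoevAux]; bicategory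

theorem leftCoevAux_ract : b.alg.mul ≫ leftCoevAux X =
    b.alg.obj ◁ leftCoevAux X ≫ (α_ _ _ _).inv ≫ dualRact X.lact ▷ X.obj := by
  have h := dualRact_assoc _ _ X.lact_assoc
  rw [leftCoevAux_eq]
  calc _ = 𝟙 _ ⊗≫ (b.alg.mul ▷ 𝟙 _ ≫ b.alg.obj ◁ coev X.obj) ⊗≫ dualRact X.lact ▷ X.obj := by
        bicategory
    _ = 𝟙 _ ⊗≫ (b.alg.obj ≫ b.alg.obj) ◁ coev X.obj ⊗≫
        (b.alg.mul ▷ X.obj† ≫ dualRact X.lact) ▷ X.obj := by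
        rw [← whisker_exchange]; bicategory
    _ = _ := by rw [h]; bicategory

/-- The zigzag on `X`: after the zigzag identity of `X† ⊣ X` in `B`, the two legs of the copairing
of `A` act on `X` in succession, which is the identity by separability. -/
theorem left_zigzag_bimodule : X.obj ◁ leftCoevAux X ≫ (α_ _ _ _).inv ≫ leftEvAux X ▷ X.obj ≫
    X.ract = X.lact := by
  have h := X.act_comm
  calc _ = 𝟙 _ ⊗≫ X.obj ◁ coev X.obj ▷ b.alg.obj ⊗≫ ((X.obj ≫ X.obj†) ◁ X.lact ≫
        leftEvAux X ▷ X.obj) ≫ X.ract := by simp only [leftCoevAux]; bicategory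
    _ = 𝟙 _ ⊗≫ X.obj ◁ coev X.obj ▷ b.alg.obj ⊗≫ leftEvAux X ▷ (X.obj ≫ b.alg.obj) ⊗≫
        ((α_ _ _ _).hom ≫ a.alg.obj ◁ X.lact ≫ X.ract) := by rw [whisker_exchange]; bicategory
    _ = 𝟙 _ ⊗≫ (𝟙 _ ◁ X.obj ◁ coev X.obj ≫ a.alg.copairing ▷ (X.obj ≫ X.obj† ≫ X.obj)) ▷ b.alg.obj
        ⊗≫ a.alg.obj ◁ X.ract ▷ X.obj† ▷ X.obj ▷ b.alg.obj ⊗≫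
        a.alg.obj ◁ ev X.obj ▷ X.obj ▷ b.alg.obj ⊗≫ X.ract ▷ b.alg.obj ≫ X.lact := by
      rw [← h, leftEvAux]; bicategory
    _ = 𝟙 _ ⊗≫ a.alg.copairing ▷ X.obj ▷ b.alg.obj
        ⊗≫ a.alg.obj ◁ ((a.alg.obj ≫ X.obj) ◁ coev X.obj ≫ X.ract ▷ (X.obj† ≫ X.obj)) ▷ b.alg.obj
        ⊗≫
        a.alg.obj ◁ ev X.obj ▷ X.obj ▷ b.alg.obj ⊗≫ X.ract ▷ b.alg.obj ≫ X.lact := by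
      rw [whisker_exchange]; bicategory
    _ = 𝟙 _ ⊗≫ a.alg.copairing ▷ X.obj ▷ b.alg.obj
        ⊗≫ a.alg.obj ◁ X.ract ▷ b.alg.obj ⊗≫
        a.alg.obj ◁ (X.obj ◁ coev X.obj ⊗≫ ev X.obj ▷ X.obj) ▷ b.alg.obj ⊗≫
          X.ract ▷ b.alg.obj ≫ X.lact := by
      rw [whisker_exchange]; bicategory
    _ = 𝟙 _ ⊗≫ (a.alg.copairing ▷ X.obj ≫ (α_ _ _ _).hom ≫ a.alg.obj ◁ X.ract ≫ X.ract) ▷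
          b.alg.obj ≫ X.lact := by
      rw [z2]; bicategory
    _ = _ := by rw [X.copairing_ract]; bicategory

/-- The zigzag on `⋆X`: tested against `ev_X`, it reduces to the zigzag on `X`. -/
theorem left_zigzag_dual : leftCoevAux X ▷ X.obj† ≫ (α_ _ _ _).hom ≫ X.obj† ◁ leftEvAux X ≫
    leftDualLact X = dualRact X.lact := by
  have h := left_zigzag_bimodule X
  apply ext_left
  rw [dualRact_ev]
  calc _ = X.obj ◁ leftCoevAux X ▷ X.obj† ⊗≫ X.obj ◁ X.obj† ◁ leftEvAux X ≫
        (X.obj ◁ leftDualLact X ≫ ev X.obj) := by bicategory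
    _ = 𝟙 _ ⊗≫ X.obj ◁ leftCoevAux X ▷ X.obj† ⊗≫ ((X.obj ≫ X.obj†) ◁ leftEvAux X ≫
        leftEvAux X ▷ a.alg.obj) ≫ a.alg.pairing := by
      rw [leftDualLact_ev]; bicategory
    _ = 𝟙 _ ⊗≫ X.obj ◁ leftCoevAux X ▷ X.obj† ⊗≫ leftEvAux X ▷ (X.obj ≫ X.obj†) ≫
        a.alg.obj ◁ leftEvAux X ≫ a.alg.pairing := by
      rw [whisker_exchange]; bicategory
    _ = 𝟙 _ ⊗≫ (X.obj ◁ leftCoevAux X ≫ (α_ _ _ _).inv ≫ leftEvAux X ▷ X.obj ≫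
        X.ract) ▷ X.obj† ≫ ev X.obj := by
      rw [leftEvAux_pairing]; bicategory
    _ = _ := by rw [h]; bicategory

theorem leftDual_ract : (leftDual X).ract = dualRact X.lact := by
  change 𝟙 _ ▷ _ ≫ dualRact X.lact = _
  simp

theorem exists_adjunction_leftDual [∀ x y : B, IsIdempotentComplete (x ⟶ y)] :
    ∃ adj : Bicategory.Adjunction (a := b) (b := a) (leftDual X) X,
      BimoduleHom.hom adj.counit = leftEv X ∧ BimoduleHom.hom adj.unit = leftCoev X := by
  have hr := leftDual_ract X
  refine exists_adjunction (X := X) (L := leftDual X) (E := leftEvAux X) (C := leftCoevAux X)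
    ?_ (leftEvAux_lact X) (leftEvAux_ract X) (leftCoevAux_lact X) ?_ ?_ (left_zigzag_bimodule X)
  · rw [hr]; exact leftEvAux_balanced X
  · rw [hr]; exact leftCoevAux_ract X
  · rw [hr]; exact left_zigzag_dual X

/-! ### The right dual -/

theorem rightEvAux_lact : (α_ _ _ _).hom ≫ X.obj† ◁ X.lact ≫ rightEvAux X =
    rightEvAux X ▷ b.alg.obj ≫ b.alg.mul := by
  have h := rightEvAux_pairing X
  have hl := X.lact_assoc
  have hp := b.alg.mul_pairing
  refine b.alg.pairing_ext_right ?_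
  calc _ = 𝟙 _ ⊗≫ X.obj† ◁ X.lact ▷ b.alg.obj ⊗≫ (rightEvAux X ▷ b.alg.obj ≫ b.alg.pairing) := by
        bicategory
    _ = 𝟙 _ ⊗≫ X.obj† ◁ (X.lact ▷ b.alg.obj ≫ X.lact) ≫ tev X.obj := by
        rw [h]; bicategory
    _ = 𝟙 _ ⊗≫ (X.obj† ≫ X.obj) ◁ b.alg.mul ⊗≫
        ((α_ _ _ _).hom ≫ X.obj† ◁ X.lact ≫ tev X.obj) := by rw [hl]; bicategory
    _ = 𝟙 _ ⊗≫ ((X.obj† ≫ X.obj) ◁ b.alg.mul ≫ rightEvAux X ▷ b.alg.obj) ≫ b.alg.pairing := by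
        rw [← h]; bicategory
    _ = 𝟙 _ ⊗≫ rightEvAux X ▷ (b.alg.obj ≫ b.alg.obj) ⊗≫
        ((α_ _ _ _).hom ≫ b.alg.obj ◁ b.alg.mul ≫ b.alg.pairing) := by
        rw [whisker_exchange]; bicategory
    _ = _ := by rw [← hp]; bicategory

theorem rightEvAux_ract : (α_ _ _ _).inv ≫ rightDualRact X ▷ X.obj ≫ rightEvAux X =
    b.alg.obj ◁ rightEvAux X ≫ b.alg.mul := by
  have h := rightEvAux_pairing X
  have hr := rightDualRact_tev X
  have hl := rightEvAux_lact X
  have hp := b.alg.mul_pairing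
  refine b.alg.pairing_ext_right ?_
  calc _ = 𝟙 _ ⊗≫ rightDualRact X ▷ X.obj ▷ b.alg.obj ⊗≫
        (rightEvAux X ▷ b.alg.obj ≫ b.alg.pairing) := by bicategory
    _ = 𝟙 _ ⊗≫ (rightDualRact X ▷ (X.obj ≫ b.alg.obj) ≫ X.obj† ◁ X.lact) ≫ tev X.obj := by
        rw [h]; bicategory
    _ = 𝟙 _ ⊗≫ (b.alg.obj ≫ X.obj†) ◁ X.lact ⊗≫ (rightDualRact X ▷ X.obj ≫ tev X.obj) := by
        rw [← whisker_exchange]; bicategory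
    _ = 𝟙 _ ⊗≫ b.alg.obj ◁ ((α_ _ _ _).hom ≫ X.obj† ◁ X.lact ≫ rightEvAux X) ⊗≫
        b.alg.pairing := by rw [hr]; bicategory
    _ = 𝟙 _ ⊗≫ b.alg.obj ◁ (rightEvAux X ▷ b.alg.obj) ⊗≫
        ((α_ _ _ _).hom ≫ b.alg.obj ◁ b.alg.mul ≫ b.alg.pairing) := by
        rw [hl]; bicategory
    _ = _ := by rw [← hp]; bicategory

theorem rightEvAux_balanced : dualLact X.ract ▷ X.obj ≫ rightEvAux X =
    (α_ _ _ _).hom ≫ X.obj† ◁ X.ract ≫ rightEvAux X := by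
  have h := rightEvAux_pairing X
  have hr := dualLact_tev X.ract
  have hc := X.act_comm
  refine b.alg.pairing_ext_right (Eq.symm ?_)
  calc _ = 𝟙 _ ⊗≫ X.obj† ◁ X.ract ▷ b.alg.obj ⊗≫ (rightEvAux X ▷ b.alg.obj ≫ b.alg.pairing) := by
        bicategory
    _ = 𝟙 _ ⊗≫ X.obj† ◁ (X.ract ▷ b.alg.obj ≫ X.lact) ≫ tev X.obj := by
        rw [h]; bicategory
    _ = 𝟙 _ ⊗≫ (X.obj† ≫ a.alg.obj) ◁ X.lact ⊗≫
        ((α_ _ _ _).hom ≫ X.obj† ◁ X.ract ≫ tev X.obj) := by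
        rw [hc]; bicategory
    _ = 𝟙 _ ⊗≫ ((X.obj† ≫ a.alg.obj) ◁ X.lact ≫ dualLact X.ract ▷ X.obj) ⊗≫ tev X.obj := by
        rw [← hr]; bicategory
    _ = 𝟙 _ ⊗≫ dualLact X.ract ▷ (X.obj ≫ b.alg.obj) ⊗≫
        ((α_ _ _ _).hom ≫ X.obj† ◁ X.lact ≫ tev X.obj) := by
        rw [whisker_exchange]; bicategory
    _ = _ := by rw [← h]; bicategory

theorem rightCoevAux_ract : a.alg.mul ≫ rightCoevAux X =
    a.alg.obj ◁ rightCoevAux X ≫ (α_ _ _ _).inv ≫ X.ract ▷ X.obj† := by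
  have h := X.ract_assoc
  calc _ = 𝟙 _ ⊗≫ (a.alg.mul ▷ 𝟙 _ ≫ a.alg.obj ◁ tcoev X.obj) ⊗≫ X.ract ▷ X.obj† ⊗≫ 𝟙 _ := by
        simp only [rightCoevAux]; bicategory
    _ = 𝟙 _ ⊗≫ (a.alg.obj ≫ a.alg.obj) ◁ tcoev X.obj ⊗≫
          (a.alg.mul ▷ X.obj ≫ X.ract) ▷ X.obj† ⊗≫ 𝟙 _ := by
        rw [← whisker_exchange]; bicategory
    _ = _ := by rw [h, rightCoevAux]; bicategory

theorem rightCoevAux_eq : rightCoevAux X =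
    (λ_ _).inv ≫ tcoev X.obj ▷ a.alg.obj ≫ (α_ _ _ _).hom ≫ X.obj ◁ dualLact X.ract := by
  rw [tcoev_dualLact, rightCoevAux]; bicategory

theorem rightCoevAux_lact : a.alg.mul ≫ rightCoevAux X =
    rightCoevAux X ▷ a.alg.obj ≫ (α_ _ _ _).hom ≫ X.obj ◁ dualLact X.ract := by
  have h := dualLact_assoc _ _ X.ract_assoc
  rw [rightCoevAux_eq]
  calc _ = 𝟙 _ ⊗≫ (𝟙 _ ◁ a.alg.mul ≫ tcoev X.obj ▷ a.alg.obj) ⊗≫ X.obj ◁ dualLact X.ract := by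
        bicategory
    _ = 𝟙 _ ⊗≫ tcoev X.obj ▷ (a.alg.obj ≫ a.alg.obj) ⊗≫
        X.obj ◁ ((α_ _ _ _).hom ≫ X.obj† ◁ a.alg.mul ≫ dualLact X.ract) := by
        rw [whisker_exchange]; bicategory
    _ = _ := by rw [← h]; bicategory

/-- The zigzag on `X`; as for the left dual, separability makes the two legs of the copairing of
`B` act on `X` as the identity. -/
theorem right_zigzag_bimodule : rightCoevAux X ▷ X.obj ≫ (α_ _ _ _).hom ≫
    X.obj ◁ rightEvAux X ≫ X.lact = X.ract := by
  have h := X.act_comm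
  calc _ = 𝟙 _ ⊗≫ a.alg.obj ◁ tcoev X.obj ▷ X.obj ⊗≫ (X.ract ▷ (X.obj† ≫ X.obj) ≫
        X.obj ◁ rightEvAux X) ≫ X.lact := by simp only [rightCoevAux]; bicategory
    _ = 𝟙 _ ⊗≫ a.alg.obj ◁ tcoev X.obj ▷ X.obj ⊗≫ (a.alg.obj ≫ X.obj) ◁ rightEvAux X ⊗≫
        (X.ract ▷ b.alg.obj ≫ X.lact) := by rw [← whisker_exchange]; bicategory
    _ = 𝟙 _ ⊗≫ a.alg.obj ◁ (tcoev X.obj ▷ X.obj ▷ 𝟙 _ ≫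
          ((X.obj ≫ X.obj†) ≫ X.obj) ◁ b.alg.copairing) ⊗≫
        a.alg.obj ◁ X.obj ◁ X.obj† ◁ X.lact ▷ b.alg.obj ⊗≫
        a.alg.obj ◁ X.obj ◁ tev X.obj ▷ b.alg.obj ⊗≫ a.alg.obj ◁ X.lact ≫ X.ract := by
      rw [h, rightEvAux]; bicategory
    _ = 𝟙 _ ⊗≫ a.alg.obj ◁ X.obj ◁ b.alg.copairing ⊗≫
        a.alg.obj ◁ (tcoev X.obj ▷ (X.obj ≫ b.alg.obj) ≫ (X.obj ≫ X.obj†) ◁ X.lact) ▷ b.alg.obj ⊗≫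
        a.alg.obj ◁ X.obj ◁ tev X.obj ▷ b.alg.obj ⊗≫ a.alg.obj ◁ X.lact ≫ X.ract := by
      rw [← whisker_exchange]; bicategory
    _ = 𝟙 _ ⊗≫ a.alg.obj ◁ X.obj ◁ b.alg.copairing ⊗≫ a.alg.obj ◁ X.lact ▷ b.alg.obj ⊗≫
        a.alg.obj ◁ (tcoev X.obj ▷ X.obj ⊗≫ X.obj ◁ tev X.obj) ▷ b.alg.obj ⊗≫
          a.alg.obj ◁ X.lact ≫ X.ract := by
      rw [← whisker_exchange]; bicategory
    _ = 𝟙 _ ⊗≫ a.alg.obj ◁ (X.obj ◁ b.alg.copairing ≫ (α_ _ _ _).inv ≫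
          X.lact ▷ b.alg.obj ≫ X.lact) ≫ X.ract := by
      rw [z3]; bicategory
    _ = _ := by rw [X.copairing_lact]; bicategory

/-- The zigzag on `X⋆`: tested against `tev_X`, it reduces to the zigzag on `X`. -/
theorem right_zigzag_dual : X.obj† ◁ rightCoevAux X ≫ (α_ _ _ _).inv ≫ rightEvAux X ▷ X.obj† ≫
    rightDualRact X = dualLact X.ract := by
  have h := right_zigzag_bimodule X
  apply ext_right
  rw [dualLact_tev]
  calc _ = 𝟙 _ ⊗≫ X.obj† ◁ rightCoevAux X ▷ X.obj ⊗≫ rightEvAux X ▷ X.obj† ▷ X.obj ≫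
        (rightDualRact X ▷ X.obj ≫ tev X.obj) := by bicategory
    _ = 𝟙 _ ⊗≫ X.obj† ◁ rightCoevAux X ▷ X.obj ⊗≫ (rightEvAux X ▷ (X.obj† ≫ X.obj) ≫
        b.alg.obj ◁ rightEvAux X) ≫ b.alg.pairing := by
      rw [rightDualRact_tev]; bicategory
    _ = 𝟙 _ ⊗≫ X.obj† ◁ rightCoevAux X ▷ X.obj ⊗≫ (X.obj† ≫ X.obj) ◁ rightEvAux X ≫
        rightEvAux X ▷ b.alg.obj ≫ b.alg.pairing := by
      rw [← whisker_exchange]; bicategory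
    _ = 𝟙 _ ⊗≫ X.obj† ◁ (rightCoevAux X ▷ X.obj ≫ (α_ _ _ _).hom ≫
        X.obj ◁ rightEvAux X ≫ X.lact) ≫ tev X.obj := by
      rw [rightEvAux_pairing]; bicategory
    _ = _ := by rw [h]; bicategory

theorem rightDual_lact : (rightDual X).lact = dualLact X.ract := by
  change _ ◁ 𝟙 _ ≫ dualLact X.ract = _
  simp

theorem exists_adjunction_rightDual [∀ x y : B, IsIdempotentComplete (x ⟶ y)] :
    ∃ adj : Bicategory.Adjunction (a := a) (b := b) X (rightDual X),
      BimoduleHom.hom adj.counit = rightEv X ∧ BimoduleHom.hom adj.unit = rightCoev X := by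
  have hl := rightDual_lact X
  refine exists_adjunction (X := rightDual X) (L := X) (E := rightEvAux X) (C := rightCoevAux X)
    ?_ (rightEvAux_lact X) (rightEvAux_ract X) ?_ (rightCoevAux_ract X)
    (right_zigzag_bimodule X) ?_
  · rw [hl]; exact rightEvAux_balanced X
  · rw [hl]; exact rightCoevAux_lact X
  · rw [hl]; exact right_zigzag_dual X
end

end EquivariantCompletion

theorem proposition4p6 {B : Type u} [Bicategory.{w, v} B]
    [∀ x y : B, IsIdempotentComplete (x ⟶ y)] [EquivariantCompletion.PivotalBicategory B]
    {a b : EquivariantCompletion.Beq B} (X : a ⟶ b) :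
    (∃ adj : Bicategory.Adjunction (a := b) (b := a) (EquivariantCompletion.leftDual X) X,
      EquivariantCompletion.BimoduleHom.hom adj.counit = EquivariantCompletion.leftEv X ∧
      EquivariantCompletion.BimoduleHom.hom adj.unit = EquivariantCompletion.leftCoev X) ∧
    (∃ adj : Bicategory.Adjunction (a := a) (b := b) X (EquivariantCompletion.rightDual X),
      EquivariantCompletion.BimoduleHom.hom adj.counit = EquivariantCompletion.rightEv X ∧
      EquivariantCompletion.BimoduleHom.hom adj.unit = EquivariantCompletion.rightCoev X) :=
  ⟨EquivariantCompletion.exists_adjunction_leftDual X,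
    EquivariantCompletion.exists_adjunction_rightDual X⟩
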